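/- Let $k$ be a field. A \emph{tensor category} over $k$ means a finite tensor category: a $k$-linear abelian rigid monoidal category with $k$-bilinear tensor product, with finitely many simple objects up to isomorphism, finite-dimensional morphism spaces, enough projectives and all objects of finite length, whose unit object $\mathbf 1$ is simple with $\operatorname{End}(\mathbf 1)=k$. For an object $V$ of a tensor category $\mathcal C$ put $H^\bullet(\mathcal C,V)=\bigoplus_{n\ge 0}\operatorname{Ext}^n_{\mathcal C}(\mathbf 1,V)$; under the Yoneda product $H^\bullet(\mathcal C,\mathbf 1)$ is a graded $k$-algebra and $H^\bullet(\mathcal C,V)$ is a module over it. $\mathcal C$ is \emph{of finite type} if $H^\bullet(\mathcal C,\mathbf 1)$ is a finitely generated $k$-algebra and $H^\bullet(\mathcal C,V)$ is a finitely generated $H^\bullet(\mathcal C,\mathbf 1)$-module for every object $V$ of $\mathcal C$; in this case $\operatorname{Kdim}\mathcal C$ denotes the Krull dimension (supremum of lengths of chains of prime ideals) of the commutative even subalgebra $H^{ev}(\mathcal C,\mathbf 1)=\bigoplus_{n\ge 0}\operatorname{Ext}^{2n}_{\mathcal C}(\mathbf 1,\mathbf 1)$. Let $\mathcal D,\mathcal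 C$ be tensor categories over $k$ and let $F:\mathcal D\to\mathcal C$ be a tensor functor (an exact $k$-linear strong monoidal functor) which is surjective, i.e. every object of $\mathcal C$ is a subquotient of $F(X)$ for some object $X$ of $\mathcal D$. If $\mathcal D$ is of finite type, then $\mathcal C$ is of finite type. Furthermore, in this case: (i) the algebra map $H^\bullet(\mathcal D,\mathbf 1)\to H^\bullet(\mathcal C,\mathbf 1)$ induced by $F$ is finite, i.e. $H^\bullet(\mathcal C,\mathbf 1)$ is a finitely generated $H^\bullet(\mathcal D,\mathbf 1)$-module; (ii) $\operatorname{Kdim}\mathcal C\le\operatorname{Kdim}\mathcal D$. -/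

import Mathlib

open CategoryTheory CategoryTheory.Limits CategoryTheory.Abelian CategoryTheory.MonoidalCategory
open scoped DirectSum

universe w w₁ w₂ v v₁ v₂ u u₁ u₂ u₀

namespace TensorCohomology

/-! ### Finite tensor categories -/

/-- A finite tensor category over the field `k`: a `k`-linear abelian rigid monoidal category with
`k`-bilinear tensor product, which is finite as a `k`-linear category (finitely many simple objects
up to isomorphism, finite dimensional morphism spaces, enough projectives, all objects of finite
length), whose unit object is simple with `End(𝟙) = k`. -/
class IsFiniteTensorCategory (k : Type u₀) [Field k] (C : Type u) [Category.{v} C] [Abelian C]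
    [Linear k C] [MonoidalCategory C] [MonoidalPreadditive C] [MonoidalLinear k C]
    [RigidCategory C] : Prop where
  finite_simples : ∃ (n : ℕ) (S : Fin n → C), ∀ X : C, Simple X → ∃ i, Nonempty (X ≅ S i)
  finite_hom : ∀ X Y : C, Module.Finite k (X ⟶ Y)
  enoughProjectives : EnoughProjectives C
  /-- Finite length, i.e. the ascending and the descending chain conditions on subobjects. -/
  finite_length : ∀ X : C, IsNoetherianObject X ∧ IsArtinianObject X
  simple_unit : Simple (𝟙_ C)
  end_unit : Function.Bijective (fun r : k => (r • 𝟙 (𝟙_ C) : 𝟙_ C ⟶ 𝟙_ C))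

/-- `V` is a subquotient of `W`: a quotient of a subobject of `W`. -/
def IsSubquotient {C : Type u} [Category.{v} C] (V W : C) : Prop :=
  ∃ (S : C) (i : S ⟶ W) (p : S ⟶ V), Mono i ∧ Epi p

/-- A functor `F : D ⥤ C` is surjective if every object of `C` is a subquotient of some `F(X)`. -/
def IsSurjectiveFunctor {D : Type u₁} [Category.{v₁} D] {C : Type u₂} [Category.{v₂} C]
    (F : D ⥤ C) : Prop :=
  ∀ V : C, ∃ X : D, IsSubquotient V (F.obj X)

/-! ### The Yoneda product -/

section Yoneda

variable {C : Type u} [Category.{v} C] [Abelian C] [HasExt.{w} C]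

/-- The graded group `n ↦ Ext^n(X, Y)`. -/
abbrev ExtFam (X Y : C) (n : ℕ) : Type w := Ext.{w} X Y n

/-- The total extension group `Ext^•(X, Y) = ⨁ n, Ext^n(X, Y)`. -/
abbrev ExtTotal (X Y : C) : Type w := ⨁ n : ℕ, ExtFam X Y n

theorem gradedMk_comp {X Y Z : C} {a b c c' : ℕ} (α : Ext.{w} X Y a) (β : Ext.{w} Y Z b)
    (h : a + b = c) (h' : a + b = c') :
    (GradedMonoid.mk c (α.comp β h) : GradedMonoid (ExtFam X Z)) =
      GradedMonoid.mk c' (α.comp β h') := by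
  subst h
  subst h'
  rfl

theorem gradedMk_id_comp {X Y : C} {n : ℕ} (α : Ext.{w} X Y n) :
    (GradedMonoid.mk (0 + n) ((Ext.mk₀ (𝟙 X)).comp α rfl) : GradedMonoid (ExtFam X Y)) =
      GradedMonoid.mk n α := by
  rw [gradedMk_comp _ _ rfl (zero_add n), Ext.mk₀_id_comp]

theorem gradedMk_comp_id {X Y : C} {n : ℕ} (α : Ext.{w} X Y n) :
    (GradedMonoid.mk (n + 0) (α.comp (Ext.mk₀ (𝟙 Y)) rfl) : GradedMonoid (ExtFam X Y)) =
      GradedMonoid.mk n α := by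
  rw [gradedMk_comp _ _ rfl (add_zero n), Ext.comp_mk₀_id]

theorem gradedMk_comp_assoc {X Y Z T : C} {a b c : ℕ} (α : Ext.{w} X Y a) (β : Ext.{w} Y Z b)
    (γ : Ext.{w} Z T c) :
    (GradedMonoid.mk (a + b + c) ((α.comp β rfl).comp γ rfl) : GradedMonoid (ExtFam X T)) =
      GradedMonoid.mk (a + (b + c)) (α.comp (β.comp γ rfl) rfl) := by
  rw [Ext.comp_assoc α β γ rfl rfl rfl]
  exact gradedMk_comp _ _ _ _

noncomputable instance extGMonoid (X : C) : GradedMonoid.GMonoid (ExtFam X X) :=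
  letI : GradedMonoid.GOne (ExtFam X X) := ⟨Ext.mk₀ (𝟙 X)⟩
  letI : GradedMonoid.GMul (ExtFam X X) := ⟨fun α β => α.comp β rfl⟩
  { one := Ext.mk₀ (𝟙 X)
    mul := fun α β => α.comp β rfl
    one_mul := fun a => gradedMk_id_comp a.2
    mul_one := fun a => gradedMk_comp_id a.2
    mul_assoc := fun a b c => gradedMk_comp_assoc a.2 b.2 c.2 }

/-- `Ext^•(X, X)` is a graded ring under the Yoneda product, written in diagrammatic order:
`α * β` is `α : X ⟶ X[a]` followed by `β[a] : X[a] ⟶ X[a + b]`. For the unit object this is also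
the concatenation `α ⊗ β`. -/
noncomputable instance extGRing (X : C) : DirectSum.GRing (ExtFam X X) :=
  { extGMonoid X with
    mul_zero := fun α => Ext.comp_zero α _ _ _ _
    zero_mul := fun β => Ext.zero_comp _ _ β _ _
    mul_add := fun α β γ => Ext.comp_add α β γ _
    add_mul := fun α β γ => Ext.add_comp α β γ _
    natCast := fun n => n • Ext.mk₀ (𝟙 X)
    natCast_zero := zero_nsmul _
    natCast_succ := fun n => succ_nsmul _ n
    intCast := fun n => n • Ext.mk₀ (𝟙 X)
    intCast_ofNat := fun n => natCast_zsmul _ n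
    intCast_negSucc_ofNat := fun n => negSucc_zsmul _ n }

/-- `Ext^•(X, V)` is a graded module over `Ext^•(X, X)`: `α • β` is `α` followed by `β`. -/
noncomputable instance extGmodule (X V : C) : DirectSum.Gmodule (ExtFam X X) (ExtFam X V) where
  smul α β := α.comp β rfl
  one_smul b := gradedMk_id_comp b.2
  mul_smul a b c := gradedMk_comp_assoc a.2 b.2 c.2
  smul_add α β γ := Ext.comp_add α β γ _
  smul_zero α := Ext.comp_zero α _ _ _ _
  add_smul α β γ := Ext.add_comp α β γ _
  zero_smul β := Ext.zero_comp _ _ β _ _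

/-- The `k`-algebra structure on `Ext^•(X, X)`. -/
noncomputable instance extGAlgebra (k : Type u₀) [Field k] [Linear k C] (X : C) :
    DirectSum.GAlgebra k (ExtFam X X) where
  toFun :=
    { toFun := fun r => r • Ext.mk₀ (𝟙 X)
      map_zero' := zero_smul _ _
      map_add' := fun r s => add_smul r s _ }
  map_one := one_smul k (Ext.mk₀ (𝟙 X))
  map_mul r s := by
    refine Eq.trans ?_ (congrArg (fun z => (GradedMonoid.mk 0 z : GradedMonoid (ExtFam X X)))
      (show (r * s) • Ext.mk₀ (𝟙 X) = (r • Ext.mk₀ (𝟙 X)).comp (s • Ext.mk₀ (𝟙 X)) rfl by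
        rw [Ext.smul_comp, Ext.comp_smul, mul_smul, Ext.mk₀_id_comp]))
    rfl
  commutes r x := by
    obtain ⟨n, α⟩ := x
    change GradedMonoid.mk (0 + n) ((r • Ext.mk₀ (𝟙 X)).comp α rfl) =
      GradedMonoid.mk (n + 0) (α.comp (r • Ext.mk₀ (𝟙 X)) rfl)
    rw [gradedMk_comp _ _ rfl (zero_add n), gradedMk_comp _ _ rfl (add_zero n),
      Ext.smul_comp, Ext.comp_smul, Ext.mk₀_id_comp, Ext.comp_mk₀_id]
  smul_def r x := by
    obtain ⟨n, α⟩ := x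
    change GradedMonoid.mk n (r • α) = GradedMonoid.mk (0 + n) ((r • Ext.mk₀ (𝟙 X)).comp α rfl)
    rw [gradedMk_comp _ _ rfl (zero_add n), Ext.smul_comp, Ext.mk₀_id_comp]

/-- The even subalgebra `⨁ n, Ext^{2n}(X, X)` of `Ext^•(X, X)`. -/
noncomputable def evenSubalgebra (k : Type u₀) [Field k] [Linear k C] (X : C) :
    Subalgebra k (ExtTotal X X) where
  carrier := {x | ∀ n : ℕ, Odd n → x n = 0}
  zero_mem' _ _ := rfl
  one_mem' n hn := DirectSum.of_eq_of_ne _ _ _ (by rintro rfl; simp at hn)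
  add_mem' hx hy n hn := by
    rw [DirectSum.add_apply, hx n hn, hy n hn, add_zero]
  mul_mem' {x y} hx hy n hn := by
    classical
    rw [DirectSum.mul_eq_sum_support_ghas_mul, DFinsupp.finsetSum_apply]
    refine Finset.sum_eq_zero fun p _ => ?_
    by_cases h : p.1 + p.2 = n
    · subst h
      have h0 : (GradedMonoid.GMul.mul (x p.1) (y p.2) : ExtFam X X (p.1 + p.2)) = 0 := by
        rcases Nat.even_or_odd p.1 with h1 | h1
        · rw [hy p.2 ((Nat.odd_add'.1 hn).2 h1)]
          exact DirectSum.GNonUnitalNonAssocSemiring.mul_zero _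
        · rw [hx p.1 h1]
          exact DirectSum.GNonUnitalNonAssocSemiring.zero_mul _
      rw [h0, map_zero]
      rfl
    · exact DirectSum.of_eq_of_ne _ _ _ (Ne.symm h)
  algebraMap_mem' r n hn := DirectSum.of_eq_of_ne _ _ _ (by rintro rfl; simp at hn)

end Yoneda

/-! ### Maps induced by exact functors -/

section Map

variable (k : Type u₀) [Field k]
variable {D : Type u₁} [Category.{v₁} D] [Abelian D] [Linear k D] [HasExt.{w₁} D]
variable {C : Type u₂} [Category.{v₂} C] [Abelian C] [Linear k C] [HasExt.{w₂} C]

/-- The algebra map `Ext^•_D(X, X) → Ext^•_C(Y, Y)` induced by an exact `k`-linear functor `F` and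
an isomorphism `e : Y ≅ F(X)`, given in degree `n` by applying `F` and conjugating with `e`. -/
noncomputable def extMap (F : D ⥤ C) [F.Additive] [F.Linear k] [PreservesFiniteLimits F]
    [PreservesFiniteColimits F] {X : D} {Y : C} (e : Y ≅ F.obj X) :
    ExtTotal.{w₁} X X →ₐ[k] ExtTotal.{w₂} Y Y :=
  DirectSum.toAlgebra k (ExtFam X X)
    (fun n => (DirectSum.lof k ℕ (ExtFam Y Y) n).comp
      ((Ext.precompOfLinear (Ext.mk₀ e.hom) k Y (zero_add n)).comp
        ((Ext.postcompOfLinear (Ext.mk₀ e.inv) k (F.obj X) (add_zero n)).comp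
          (F.mapExtLinearMap k X X n))))
    (by
      refine (congrArg (DirectSum.of (ExtFam Y Y) 0)
        (show (Ext.mk₀ e.hom).comp (((Ext.mk₀ (𝟙 X)).mapExactFunctor F).comp (Ext.mk₀ e.inv)
          (add_zero 0)) (zero_add 0) = Ext.mk₀ (𝟙 Y) from ?_))
      rw [Ext.mapExactFunctor_mk₀, F.map_id, Ext.mk₀_id_comp, Ext.mk₀_comp_mk₀, e.hom_inv_id])
    (by
      intro i j α β
      have key : ∀ {n : ℕ} (γ : Ext.{w₂} Y (F.obj X) i) (δ : Ext.{w₂} (F.obj X) Y j)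
          (h : i + j = n), (γ.comp (Ext.mk₀ e.inv) (add_zero i)).comp
          ((Ext.mk₀ e.hom).comp δ (zero_add j)) h = γ.comp δ h := by
        intro n γ δ h
        rw [Ext.comp_assoc_of_second_deg_zero, Ext.mk₀_comp_mk₀_assoc, e.inv_hom_id,
          Ext.mk₀_id_comp]
      refine Eq.trans (congrArg (DirectSum.of (ExtFam Y Y) (i + j)) (?_ :
        (Ext.mk₀ e.hom).comp (((α.comp β rfl).mapExactFunctor F).comp (Ext.mk₀ e.inv)
          (add_zero (i + j))) (zero_add (i + j)) =
        ((Ext.mk₀ e.hom).comp ((α.mapExactFunctor F).comp (Ext.mk₀ e.inv)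
          (add_zero i)) (zero_add i)).comp
        ((Ext.mk₀ e.hom).comp ((β.mapExactFunctor F).comp (Ext.mk₀ e.inv)
          (add_zero j)) (zero_add j)) rfl)) (DirectSum.of_mul_of _ _).symm
      rw [← Ext.comp_assoc (Ext.mk₀ e.hom) (α.mapExactFunctor F) (Ext.mk₀ e.inv) (zero_add i)
        (add_zero i) (by omega), key, Ext.mapExactFunctor_comp, ← Ext.comp_assoc (Ext.mk₀ e.hom)
        _ (Ext.mk₀ e.inv) (zero_add (i + j)) (add_zero (i + j)) (by omega),
        ← Ext.comp_assoc (Ext.mk₀ e.hom) _ _ (zero_add i) rfl (by omega),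
        Ext.comp_assoc_of_third_deg_zero])

end Map

/-! ### Cohomology, finite type and Krull dimension -/

section Cohomology

variable (k : Type u₀) [Field k]
variable (C : Type u) [Category.{v} C] [Abelian C] [Linear k C] [MonoidalCategory C]
  [HasExt.{w} C]

/-- The cohomology `H^•(C, V) = Ext^•(𝟙, V)`; it is a module over `H^•(C, 𝟙)`. -/
abbrev Cohomology {C : Type u} [Category.{v} C] [Abelian C] [MonoidalCategory C] [HasExt.{w} C]
    (V : C) : Type w :=
  ExtTotal.{w} (𝟙_ C) V

/-- `C` is of finite type over `k`: `H^•(C, 𝟙)` is a finitely generated `k`-algebra and `H^•(C, V)`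
is a finitely generated `H^•(C, 𝟙)`-module for every object `V`. -/
def IsFiniteType : Prop :=
  Algebra.FiniteType k (Cohomology.{w} (𝟙_ C)) ∧
    ∀ V : C, Module.Finite (Cohomology.{w} (𝟙_ C)) (Cohomology.{w} V)

/-- The supremum of the lengths of chains of prime ideals of `R`. It is meant for rings whose
multiplication is commutative (as that of even cohomology is, by graded commutativity of
`H^•(C, 𝟙)`), where it is the usual Krull dimension; no commutativity instance is asked for. -/
noncomputable def primeKrullDim (R : Type w) [Ring R] : WithBot ℕ∞ :=
  Order.krullDim {P : Ideal R // P.IsPrime}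

theorem primeKrullDim_eq_ringKrullDim (R : Type w) [CommRing R] :
    primeKrullDim R = ringKrullDim R :=
  (Order.krullDim_eq_of_orderIso (PrimeSpectrum.equivSubtype R)).symm

/-- `Kdim C`, the Krull dimension of the even cohomology algebra `H^{ev}(C, 𝟙)`. -/
noncomputable def kdim : WithBot ℕ∞ :=
  primeKrullDim (evenSubalgebra.{w} k (𝟙_ C))

/-- A ring homomorphism `f : A → B` is finite if it makes `B` a finitely generated `A`-module. -/
def IsFiniteRingHom {A : Type w₁} {B : Type w₂} [Ring A] [Ring B] (f : A →+* B) : Prop :=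
  letI : Module A B := Module.compHom B f
  Module.Finite A B

variable {C}
variable {D : Type u₁} [Category.{v₁} D] [Abelian D] [Linear k D] [MonoidalCategory D]
  [HasExt.{w₁} D]

/-- The algebra map `H^•(D, 𝟙) → H^•(C, 𝟙)` induced by an exact monoidal functor `F : D ⥤ C`: apply
`F` and identify `F(𝟙)` with `𝟙` through the unit isomorphism of `F`. -/
noncomputable def cohomologyMap (F : D ⥤ C) [F.Monoidal] [F.Additive] [F.Linear k]
    [PreservesFiniteLimits F] [PreservesFiniteColimits F] :
    Cohomology.{w₁} (𝟙_ D) →ₐ[k] Cohomology.{w} (𝟙_ C) :=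
  extMap k F (Functor.Monoidal.εIso F)

end Cohomology

end TensorCohomology

-- `Ext` groups always exist in a large enough universe; this is where they are taken below.
attribute [local instance] CategoryTheory.HasExt.standard

/-!
Let `F : D ⥤ C` be a surjective tensor functor between finite tensor categories and let `D` be of
finite type. The point is that `H^•(C, V)` is, for every `V`, a quotient of `H^•(D, J)` for a suitable
object `J` of `D`, compatibly with the actions of `H^•(D, 𝟙)` and `H^•(C, 𝟙)`.

* The functor `X ↦ Hom(F X, V)` is left exact and has finite dimensional values, so it has a
  universal element `x : F J ⟶ V` (`exists_universal_map`); `J` is the value at `V` of the right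
  adjoint of `F`. Every map `F X ⟶ V` factors through `x`.
* `F` preserves projective objects (`projective_map_of_surjective`, a theorem of Etingof and Ostrik).
  Hence dimension shifting along projective covers extends the factorization from maps to extension
  classes (`exists_mapExactFunctor_comp`), and `α ↦ F(α) ≫ x` is a surjection
  `H^•(D, J) ⟶ H^•(C, V)`, semilinear along the algebra map `H^•(D, 𝟙) ⟶ H^•(C, 𝟙)`
  (`finite_cohomology_of_universal_map`).

So every `H^•(C, V)` is finite over `H^•(D, 𝟙)`. This gives the finiteness of the algebra map and the
finite type property of `C`. For the Krull dimensions, even classes are central by graded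
commutativity (`ext_unit_comp_comm`), which comes down to the anticommutativity of the two connecting
classes of a `3 × 3` diagram (`extClass_comp_extClass_eq_neg`). A finitely generated cohomology algebra
is finite over its even part (`finite_evenSubalgebra`), so `H^{ev}(C, 𝟙)` is integral over the image
of `H^{ev}(D, 𝟙)`, and dimensions do not go up along integral maps.

That `F` preserves projective objects is shown by a growth argument. If some projective object has a
non-projective image, then so does every nonzero projective object, since each of them tensor
generates the others. As there are finitely many indecomposable projective objects, the size of
`F X`, measured by `dim Hom(F X, T)` for a fixed `T`, is then bounded by a constant multiple of a
quantity that only sees the non-projective part of `F X`. On the other hand surjectivity gives a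
projective `P` with `F P ≅ Q ⊞ N`, where `Q` is a projective generator, and in the decomposition
`F (P ⊗ ⋯ ⊗ P) ≅ Q' ⊞ (N ⊗ ⋯ ⊗ N)` the projective summand `Q'` outgrows the other one
(`growth_step`): each of its summands with a single factor `Q` is already comparable to it.
-/

namespace TensorCohomology

/-! ### Graded interchange in extension groups -/

section Interchange

section ThreeByThree

variable {C : Type u} [Category.{v} C] [Abelian C] [HasExt.{w} C]

omit [HasExt.{w} C] in
/-- The short exact sequence `0 ⟶ A' ⟶ K ⟶ A'' ⊞ C' ⟶ 0` of a `3 × 3` diagram with rows `R₁`, `R₂`,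
`R₃`, where `K` is the kernel of the diagonal map from the centre to the lower right corner. -/
theorem shortExact_diagonalKernel {R₁ R₂ R₃ : ShortComplex C} (f : R₁ ⟶ R₂) (g : R₂ ⟶ R₃)
    (w₁ : f.τ₁ ≫ g.τ₁ = 0) (h₁ : R₁.ShortExact) (h₂ : R₂.ShortExact) (h₃ : R₃.ShortExact)
    (hc₁ : (ShortComplex.mk f.τ₁ g.τ₁ w₁).ShortExact)
    {K : C} (ι : K ⟶ R₂.X₂) [Mono ι] [Mono f.τ₃]
    (hK : ∀ {T : C} (t : T ⟶ R₂.X₂), t ≫ R₂.g ≫ g.τ₃ = 0 → ∃ s, s ≫ ι = t)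
    (i : R₁.X₁ ⟶ K) (a : K ⟶ R₁.X₃) (c : K ⟶ R₃.X₁)
    (hi : i ≫ ι = f.τ₁ ≫ R₂.f) (ha : a ≫ f.τ₃ = ι ≫ R₂.g) (hc : c ≫ R₃.f = ι ≫ g.τ₂)
    (hw₂ : f.τ₂ ≫ g.τ₂ = 0) (hw₃ : f.τ₃ ≫ g.τ₃ = 0) (hia : i ≫ biprod.lift a c = 0) :
    (ShortComplex.mk i (biprod.lift a c) hia).ShortExact := by
  have := h₁.epi_g
  have := h₂.mono_f
  have := h₃.mono_f
  have : Mono f.τ₁ := hc₁.mono_f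
  have : Epi g.τ₁ := hc₁.epi_g
  have hmono : Mono (i ≫ ι) := by rw [hi]; infer_instance
  refine ShortComplex.ShortExact.mk' ?_ (mono_of_mono i ι) ?_
  · rw [ShortComplex.exact_iff_exact_up_to_refinements]
    intro T x hx
    dsimp at x hx
    have hxa : x ≫ a = 0 := by simpa using hx =≫ biprod.fst
    have hxc : x ≫ c = 0 := by simpa using hx =≫ biprod.snd
    have hx₁ : (x ≫ ι) ≫ R₂.g = 0 := by rw [Category.assoc, ← ha, reassoc_of% hxa, zero_comp]
    let y := h₂.exact.lift (x ≫ ι) hx₁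
    have hy : y ≫ R₂.f = x ≫ ι := h₂.exact.lift_f _ _
    have hy₁ : y ≫ g.τ₁ = 0 := by
      rw [← cancel_mono R₃.f, Category.assoc, g.comm₁₂, reassoc_of% hy, ← hc,
        reassoc_of% hxc, zero_comp]
    let z := hc₁.exact.lift y hy₁
    have hz : z ≫ f.τ₁ = y := hc₁.exact.lift_f _ _
    refine ⟨T, 𝟙 T, inferInstance, z, ?_⟩
    rw [← cancel_mono ι, Category.id_comp]
    simp only [Category.assoc]
    rw [hi, reassoc_of% hz, hy]
  · rw [epi_iff_surjective_up_to_refinements]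
    intro T t
    obtain ⟨T₁, π₁, _, u, hu⟩ := surjective_up_to_refinements_of_epi R₁.g (t ≫ biprod.fst)
    obtain ⟨T₂, π₂, _, v, hv⟩ := surjective_up_to_refinements_of_epi g.τ₁ (π₁ ≫ t ≫ biprod.snd)
    obtain ⟨s, hs⟩ := hK (π₂ ≫ u ≫ f.τ₂ + v ≫ R₂.f) (by
      have : f.τ₂ ≫ R₂.g ≫ g.τ₃ = 0 := by rw [f.comm₂₃_assoc, hw₃, comp_zero]
      simp [this])
    refine ⟨T₂, π₂ ≫ π₁, epi_comp _ _, s, ?_⟩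
    apply biprod.hom_ext
    · rw [← cancel_mono f.τ₃]
      simp only [Category.assoc, biprod.lift_fst, ha, reassoc_of% hs, Preadditive.add_comp,
        ShortComplex.zero, comp_zero, add_zero, ← f.comm₂₃, reassoc_of% hu]
    · rw [← cancel_mono R₃.f]
      simp only [Category.assoc, biprod.lift_snd, hc, reassoc_of% hs, Preadditive.add_comp,
        hw₂, comp_zero, zero_add, ← g.comm₁₂]
      rw [← reassoc_of% hv]

/-- In a `3 × 3` diagram with short exact rows and columns, the two composites of connecting
classes from the lower right to the upper left corner differ by a sign. -/
theorem extClass_comp_extClass_eq_neg {R₁ R₂ R₃ : ShortComplex C} (f : R₁ ⟶ R₂) (g : R₂ ⟶ R₃)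
    (w₁ : f.τ₁ ≫ g.τ₁ = 0) (w₂ : f.τ₂ ≫ g.τ₂ = 0) (w₃ : f.τ₃ ≫ g.τ₃ = 0)
    (h₁ : R₁.ShortExact) (h₂ : R₂.ShortExact) (h₃ : R₃.ShortExact)
    (hc₁ : (ShortComplex.mk f.τ₁ g.τ₁ w₁).ShortExact)
    (hc₃ : (ShortComplex.mk f.τ₃ g.τ₃ w₃).ShortExact) :
    hc₃.extClass.comp h₁.extClass rfl = -(h₃.extClass.comp hc₁.extClass rfl) := by
  have := h₂.epi_g
  have := h₃.mono_f
  have : Mono f.τ₃ := hc₃.mono_f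
  have : Epi g.τ₃ := hc₃.epi_g
  let p : R₂.X₂ ⟶ R₃.X₃ := R₂.g ≫ g.τ₃
  let ι := kernel.ι p
  have hι : ι ≫ R₂.g ≫ g.τ₃ = 0 := kernel.condition p
  let a : kernel p ⟶ R₁.X₃ := hc₃.exact.lift (ι ≫ R₂.g) (by simpa using hι)
  have ha : a ≫ f.τ₃ = ι ≫ R₂.g := hc₃.exact.lift_f _ _
  let c : kernel p ⟶ R₃.X₁ := h₃.exact.lift (ι ≫ g.τ₂) (by simpa [g.comm₂₃] using hι)
  have hc : c ≫ R₃.f = ι ≫ g.τ₂ := h₃.exact.lift_f _ _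
  let j : R₁.X₂ ⟶ kernel p := kernel.lift p f.τ₂ (by rw [f.comm₂₃_assoc, w₃, comp_zero])
  have hj : j ≫ ι = f.τ₂ := kernel.lift_ι _ _ _
  let l : R₂.X₁ ⟶ kernel p := kernel.lift p R₂.f (by simp [p])
  have hl : l ≫ ι = R₂.f := kernel.lift_ι _ _ _
  have hja : j ≫ a = R₁.g := by
    rw [← cancel_mono f.τ₃, Category.assoc, ha, reassoc_of% hj, f.comm₂₃]
  have hjc : j ≫ c = 0 := by
    rw [← cancel_mono R₃.f, Category.assoc, hc, reassoc_of% hj, w₂, zero_comp]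
  have hla : l ≫ a = 0 := by
    rw [← cancel_mono f.τ₃, Category.assoc, ha, reassoc_of% hl, R₂.zero, zero_comp]
  have hlc : l ≫ c = g.τ₁ := by
    rw [← cancel_mono R₃.f, Category.assoc, hc, reassoc_of% hl, g.comm₁₂]
  have hfj : R₁.f ≫ j = f.τ₁ ≫ l := by
    rw [← cancel_mono ι, Category.assoc, Category.assoc, hj, hl, f.comm₁₂]
  have hE : (ShortComplex.mk ι p (kernel.condition p)).ShortExact :=
    { exact := ShortComplex.exact_kernel p, mono_f := inferInstance, epi_g := epi_comp _ _ }
  have hL := shortExact_diagonalKernel f g w₁ h₁ h₂ h₃ hc₁ ι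
    (fun t ht => ⟨kernel.lift p t ht, kernel.lift_ι _ _ _⟩) (f.τ₁ ≫ l) a c
    (by rw [Category.assoc, hl]) ha hc w₂ w₃
    (by ext <;> simp [hla, hlc, w₁])
  -- the class of `E` maps to the class of the right column and to that of the bottom row
  have n₁ := ShortComplex.ShortExact.extClass_naturality hE hc₃
    { τ₁ := a, τ₂ := R₂.g, τ₃ := 𝟙 _, comm₁₂ := ha, comm₂₃ := by simp [p] }
  have n₂ := ShortComplex.ShortExact.extClass_naturality hE h₃
    { τ₁ := c, τ₂ := g.τ₂, τ₃ := 𝟙 _, comm₁₂ := hc, comm₂₃ := by simp [p, g.comm₂₃] }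
  -- the class of `L` restricts to the class of the top row and to that of the left column
  have n₃ := ShortComplex.ShortExact.extClass_naturality h₁ hL
    { τ₁ := 𝟙 _, τ₂ := j, τ₃ := biprod.inl, comm₁₂ := by simp [hfj]
      comm₂₃ := by ext <;> simp [hja, hjc] }
  have n₄ := ShortComplex.ShortExact.extClass_naturality hc₁ hL
    { τ₁ := 𝟙 _, τ₂ := l, τ₃ := biprod.inr, comm₁₂ := by simp
      comm₂₃ := by ext <;> simp [hla, hlc] }
  dsimp at n₁ n₂ n₃ n₄
  rw [Ext.mk₀_id_comp] at n₁ n₂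
  rw [Ext.comp_mk₀_id] at n₃ n₄
  rw [eq_neg_iff_add_eq_zero, ← n₁, ← n₂, n₃, n₄, Ext.comp_assoc_of_second_deg_zero,
    Ext.comp_assoc_of_second_deg_zero, Ext.mk₀_comp_mk₀_assoc, Ext.mk₀_comp_mk₀_assoc,
    ← Ext.comp_add, ← Ext.add_comp, ← Ext.mk₀_add]
  have : a ≫ biprod.inl + c ≫ biprod.inr = biprod.lift a c := by ext <;> simp
  rw [this, hL.comp_extClass, Ext.comp_zero]

end ThreeByThree

section Naturality

variable {D : Type u₁} [Category.{v₁} D] [Abelian D] [EnoughProjectives D] [HasExt.{w₁} D]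

/-- With enough projectives, extension classes of positive degree are products of classes of
degree one and shorter classes. -/
theorem exists_extClass_comp {X Y : D} {n : ℕ} (α : Ext.{w₁} X Y (n + 1)) :
    ∃ (S : ShortComplex D) (hS : S.ShortExact) (h : S.X₃ = X)
      (β : Ext.{w₁} S.X₁ Y n),
      α = (Ext.mk₀ (eqToHom h.symm)).comp (hS.extClass.comp β (add_comm 1 n)) (zero_add _) := by
  let p := Projective.π X
  have hS : (ShortComplex.mk (kernel.ι p) p (kernel.condition p)).ShortExact :=
    { exact := ShortComplex.exact_kernel p, mono_f := inferInstance, epi_g := inferInstance }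
  obtain ⟨β, hβ⟩ := Ext.contravariant_sequence_exact₃ hS Y α
    (Ext.eq_zero_of_projective _) (add_comm 1 n)
  refine ⟨_, hS, rfl, β, ?_⟩
  simp [hβ]

/-- Induction on extension classes: degree zero, and left multiplication by the class of a
short exact sequence. -/
theorem ext_induction {motive : ∀ (n : ℕ) (X Y : D), Ext.{w₁} X Y n → Prop}
    (mk₀ : ∀ (X Y : D) (f : X ⟶ Y), motive 0 X Y (Ext.mk₀ f))
    (extClass_comp : ∀ (n : ℕ) (S : ShortComplex D) (Y : D) (hS : S.ShortExact)
      (β : Ext.{w₁} S.X₁ Y n), motive n S.X₁ Y β →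
      motive (n + 1) S.X₃ Y (hS.extClass.comp β (add_comm 1 n)))
    {n : ℕ} {X Y : D} (α : Ext.{w₁} X Y n) : motive n X Y α := by
  induction n generalizing X with
  | zero =>
    obtain ⟨f, rfl⟩ := (Ext.mk₀_bijective X Y).2 α
    exact mk₀ _ _ f
  | succ n ih =>
    obtain ⟨S, hS, rfl, β, rfl⟩ := exists_extClass_comp α
    rw [eqToHom_refl, Ext.mk₀_id_comp]
    exact extClass_comp n S Y hS β (ih β)

variable {C : Type u₂} [Category.{v₂} C] [Abelian C] [HasExt.{w₂} C]

/-- Natural transformations between exact functors act on extension classes. -/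
theorem mapExactFunctor_comp_natTrans {F G : D ⥤ C} [F.Additive] [PreservesFiniteLimits F]
    [PreservesFiniteColimits F] [G.Additive] [PreservesFiniteLimits G] [PreservesFiniteColimits G]
    (τ : F ⟶ G) {n : ℕ} {X Y : D} (α : Ext.{w₁} X Y n) :
    (α.mapExactFunctor F).comp (Ext.mk₀ (τ.app Y)) (add_zero n) =
      (Ext.mk₀ (τ.app X)).comp (α.mapExactFunctor G : Ext.{w₂} _ _ n) (zero_add n) := by
  refine ext_induction (motive := fun n X Y α =>
    (α.mapExactFunctor F).comp (Ext.mk₀ (τ.app Y)) (add_zero n) =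
      (Ext.mk₀ (τ.app X)).comp (α.mapExactFunctor G : Ext.{w₂} _ _ n) (zero_add n)) ?_ ?_ α
  · intro X Y f
    simp [Ext.mapExactFunctor_mk₀]
  · intro n S Y hS β ih
    have nat : (hS.extClass.mapExactFunctor F).comp (Ext.mk₀ (τ.app S.X₁)) (add_zero 1) =
        (Ext.mk₀ (τ.app S.X₃)).comp (hS.extClass.mapExactFunctor G : Ext.{w₂} _ _ 1)
          (zero_add 1) := by
      rw [Ext.mapExactFunctor_extClass, Ext.mapExactFunctor_extClass]
      exact ShortComplex.ShortExact.extClass_naturality (hS.map_of_exact F) (hS.map_of_exact G)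
        (S.mapNatTrans τ)
    rw [Ext.mapExactFunctor_comp, Ext.mapExactFunctor_comp, Ext.comp_assoc_of_third_deg_zero, ih,
      ← Ext.comp_assoc_of_second_deg_zero, nat]
    exact Ext.comp_assoc _ _ _ _ _ (by omega)

theorem mapExactFunctor_id {n : ℕ} {X Y : D} (α : Ext.{w₁} X Y n) :
    α.mapExactFunctor (𝟭 D) = α := by
  refine ext_induction (motive := fun n X Y α => α.mapExactFunctor (𝟭 D) = α) ?_ ?_ α
  · intro X Y f
    exact Ext.mapExactFunctor_mk₀ _ f
  · intro n S Y hS β ih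
    rw [Ext.mapExactFunctor_comp, ih, Ext.mapExactFunctor_extClass]
    rfl

end Naturality

section Rigid

theorem ext_comp_zsmul {C : Type u} [Category.{v} C] [Abelian C] [HasExt.{w} C] {X Y Z : C}
    {a b c : ℕ} (α : Ext.{w} X Y a) (m : ℤ) (β : Ext.{w} Y Z b) (h : a + b = c) :
    α.comp (m • β) h = m • α.comp β h :=
  (α.precomp Z h).map_zsmul m β

theorem ext_zsmul_comp {C : Type u} [Category.{v} C] [Abelian C] [HasExt.{w} C] {X Y Z : C}
    {a b c : ℕ} (m : ℤ) (α : Ext.{w} X Y a) (β : Ext.{w} Y Z b) (h : a + b = c) :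
    (m • α).comp β h = m • α.comp β h :=
  (β.postcomp X h).map_zsmul m α

variable {C : Type u} [Category.{v} C] [MonoidalCategory C] [RigidCategory C]

instance tensorLeft_preservesFiniteLimits (X : C) : PreservesFiniteLimits (tensorLeft X) :=
  have := (tensorLeftAdjunction X Xᘁ).rightAdjoint_preservesLimits
  inferInstance

instance tensorLeft_preservesFiniteColimits (X : C) : PreservesFiniteColimits (tensorLeft X) :=
  have := (tensorLeftAdjunction (ᘁX) X).leftAdjoint_preservesColimits
  inferInstance

instance tensorRight_preservesFiniteLimits (X : C) : PreservesFiniteLimits (tensorRight X) :=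
  have := (tensorRightAdjunction (ᘁX) X).rightAdjoint_preservesLimits
  inferInstance

instance tensorRight_preservesFiniteColimits (X : C) : PreservesFiniteColimits (tensorRight X) :=
  have := (tensorRightAdjunction X Xᘁ).leftAdjoint_preservesColimits
  inferInstance

variable [Abelian C] [MonoidalPreadditive C] [EnoughProjectives C] [HasExt.{w} C]

omit [EnoughProjectives C] in
/-- The case of two classes of degree one: the `3 × 3` diagram `S ⊗ T`. -/
theorem extClass_interchange {S T : ShortComplex C} (hS : S.ShortExact) (hT : T.ShortExact) :
    (hS.extClass.mapExactFunctor (tensorRight T.X₃) : Ext.{w} _ _ 1).comp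
        (hT.extClass.mapExactFunctor (tensorLeft S.X₁) : Ext.{w} _ _ 1) rfl =
      -((hT.extClass.mapExactFunctor (tensorLeft S.X₃) : Ext.{w} _ _ 1).comp
        (hS.extClass.mapExactFunctor (tensorRight T.X₁) : Ext.{w} _ _ 1) rfl) := by
  rw [Ext.mapExactFunctor_extClass, Ext.mapExactFunctor_extClass,
    Ext.mapExactFunctor_extClass, Ext.mapExactFunctor_extClass]
  exact extClass_comp_extClass_eq_neg
    (R₁ := T.map (tensorLeft S.X₁)) (R₂ := T.map (tensorLeft S.X₂)) (R₃ := T.map (tensorLeft S.X₃))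
    (T.mapNatTrans ((tensoringLeft C).map S.f)) (T.mapNatTrans ((tensoringLeft C).map S.g))
    (S.map (tensorRight T.X₁)).zero (S.map (tensorRight T.X₂)).zero
    (S.map (tensorRight T.X₃)).zero (hT.map_of_exact _) (hT.map_of_exact _) (hT.map_of_exact _)
    (hS.map_of_exact (tensorRight T.X₁)) (hS.map_of_exact (tensorRight T.X₃))

/-- Graded interchange for a class of degree one and one of degree `n`. -/
theorem extClass_interchange_ext {S : ShortComplex C} (hS : S.ShortExact) {M N : C} {n : ℕ}
    (β : Ext.{w} M N n) {c : ℕ} (h : 1 + n = c) (h' : n + 1 = c) :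
    (hS.extClass.mapExactFunctor (tensorRight M) : Ext.{w} _ _ 1).comp
        (β.mapExactFunctor (tensorLeft S.X₁) : Ext.{w} _ _ n) h =
      (-1 : ℤ) ^ n • (β.mapExactFunctor (tensorLeft S.X₃) : Ext.{w} _ _ n).comp
        (hS.extClass.mapExactFunctor (tensorRight N) : Ext.{w} _ _ 1) h' := by
  subst h
  refine ext_induction (motive := fun n M N β => ∀ h' : n + 1 = 1 + n,
    (hS.extClass.mapExactFunctor (tensorRight M) : Ext.{w} _ _ 1).comp
        (β.mapExactFunctor (tensorLeft S.X₁) : Ext.{w} _ _ n) rfl =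
      (-1 : ℤ) ^ n • (β.mapExactFunctor (tensorLeft S.X₃) : Ext.{w} _ _ n).comp
        (hS.extClass.mapExactFunctor (tensorRight N) : Ext.{w} _ _ 1) h') ?_ ?_ β h'
  · intro M N f h'
    have := mapExactFunctor_comp_natTrans.{w, w} ((tensoringRight C).map f) hS.extClass
    rw [Ext.mapExactFunctor_mk₀, Ext.mapExactFunctor_mk₀, pow_zero, one_smul]
    exact this
  · intro n T N hT β ih h'
    rw [Ext.mapExactFunctor_comp, Ext.mapExactFunctor_comp,
      ← Ext.comp_assoc _ _ _ rfl _ (by omega), extClass_interchange hS hT, Ext.neg_comp,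
      Ext.comp_assoc _ _ _ _ rfl (by omega), ih (add_comm _ _), ext_comp_zsmul,
      Ext.comp_assoc _ _ _ _ (add_comm n 1) (by omega), pow_succ]
    simp

/-- Graded interchange: `(γ ▷ M) ≫ (Y ◁ β) = (-1) ^ (a b) • (X ◁ β) ≫ (γ ▷ N)` for extension classes
`γ` of degree `a` and `β` of degree `b`. -/
theorem ext_interchange {X Y M N : C} {a b : ℕ} (γ : Ext.{w} X Y a) (β : Ext.{w} M N b)
    {c : ℕ} (h : a + b = c) (h' : b + a = c) :
    (γ.mapExactFunctor (tensorRight M) : Ext.{w} _ _ a).comp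
        (β.mapExactFunctor (tensorLeft Y) : Ext.{w} _ _ b) h =
      (-1 : ℤ) ^ (a * b) • (β.mapExactFunctor (tensorLeft X) : Ext.{w} _ _ b).comp
        (γ.mapExactFunctor (tensorRight N) : Ext.{w} _ _ a) h' := by
  refine ext_induction (motive := fun a X Y γ => ∀ (c : ℕ) (h : a + b = c) (h' : b + a = c),
    (γ.mapExactFunctor (tensorRight M) : Ext.{w} _ _ a).comp
        (β.mapExactFunctor (tensorLeft Y) : Ext.{w} _ _ b) h =
      (-1 : ℤ) ^ (a * b) • (β.mapExactFunctor (tensorLeft X) : Ext.{w} _ _ b).comp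
        (γ.mapExactFunctor (tensorRight N) : Ext.{w} _ _ a) h') ?_ ?_ γ c h h'
  · intro X Y f c h h'
    obtain rfl : b = c := h'
    rw [Ext.mapExactFunctor_mk₀, Ext.mapExactFunctor_mk₀, zero_mul, pow_zero, one_smul]
    exact (mapExactFunctor_comp_natTrans.{w, w} ((tensoringLeft C).map f) β).symm
  · intro a S Y hS γ ih c h h'
    subst h'
    rw [Ext.mapExactFunctor_comp, Ext.mapExactFunctor_comp,
      Ext.comp_assoc _ _ _ _ rfl (by omega), ih _ rfl (add_comm _ _), ext_comp_zsmul,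
      ← Ext.comp_assoc _ _ _ rfl _ (by omega),
      extClass_interchange_ext hS β rfl (add_comm _ _), ext_zsmul_comp,
      Ext.comp_assoc _ _ _ _ (add_comm 1 a) (by omega), smul_smul]
    congr 1
    ring

/-- Graded commutativity of the extension algebra of the unit object. -/
theorem ext_unit_comp_comm {a b c : ℕ} (α : Ext.{w} (𝟙_ C) (𝟙_ C) a) (β : Ext.{w} (𝟙_ C) (𝟙_ C) b)
    (h : a + b = c) (h' : b + a = c) :
    α.comp β h = (-1 : ℤ) ^ (a * b) • β.comp α h' := by
  have hl : ∀ {n : ℕ} (γ : Ext.{w} (𝟙_ C) (𝟙_ C) n),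
      (γ.mapExactFunctor (tensorLeft (𝟙_ C)) : Ext.{w} _ _ n).comp (Ext.mk₀ (λ_ (𝟙_ C)).hom)
        (add_zero n) = (Ext.mk₀ (λ_ (𝟙_ C)).hom).comp γ (zero_add n) := fun γ => by
    have := mapExactFunctor_comp_natTrans.{w, w} (leftUnitorNatIso C).hom γ
    rwa [mapExactFunctor_id] at this
  have hr : ∀ {n : ℕ} (γ : Ext.{w} (𝟙_ C) (𝟙_ C) n),
      (γ.mapExactFunctor (tensorRight (𝟙_ C)) : Ext.{w} _ _ n).comp (Ext.mk₀ (λ_ (𝟙_ C)).hom)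
        (add_zero n) = (Ext.mk₀ (λ_ (𝟙_ C)).hom).comp γ (zero_add n) := fun γ => by
    have := mapExactFunctor_comp_natTrans.{w, w} (rightUnitorNatIso C).hom γ
    rw [mapExactFunctor_id] at this
    rw [unitors_equal]
    exact this
  have key := congrArg (fun z : Ext.{w} (𝟙_ C ⊗ 𝟙_ C) (𝟙_ C ⊗ 𝟙_ C) c =>
    (Ext.mk₀ (λ_ (𝟙_ C)).inv).comp (z.comp (Ext.mk₀ (λ_ (𝟙_ C)).hom) (add_zero c)) (zero_add c))
    (ext_interchange α β h h')
  rw [ext_zsmul_comp, ext_comp_zsmul] at key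
  have e₁ : ∀ {m n p : ℕ} (γ : Ext.{w} (𝟙_ C ⊗ 𝟙_ C) (𝟙_ C ⊗ 𝟙_ C) m)
      (δ : Ext.{w} (𝟙_ C ⊗ 𝟙_ C) (𝟙_ C ⊗ 𝟙_ C) n) (γ' : Ext.{w} (𝟙_ C) (𝟙_ C) m)
      (δ' : Ext.{w} (𝟙_ C) (𝟙_ C) n) (h : m + n = p)
      (_ : γ.comp (Ext.mk₀ (λ_ (𝟙_ C)).hom) (add_zero m) =
        (Ext.mk₀ (λ_ (𝟙_ C)).hom).comp γ' (zero_add m))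
      (_ : δ.comp (Ext.mk₀ (λ_ (𝟙_ C)).hom) (add_zero n) =
        (Ext.mk₀ (λ_ (𝟙_ C)).hom).comp δ' (zero_add n)),
      (Ext.mk₀ (λ_ (𝟙_ C)).inv).comp ((γ.comp δ h).comp (Ext.mk₀ (λ_ (𝟙_ C)).hom) (add_zero p))
        (zero_add p) = γ'.comp δ' h := by
    intro m n p γ δ γ' δ' h hγ hδ
    rw [Ext.comp_assoc_of_third_deg_zero, hδ, ← Ext.comp_assoc_of_second_deg_zero, hγ,
      Ext.comp_assoc _ _ _ (zero_add m) h (by omega), Ext.mk₀_comp_mk₀_assoc, Iso.inv_hom_id,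
      Ext.mk₀_id_comp]
  exact (e₁ _ _ _ _ h (hr α) (hl β)).symm.trans
    (key.trans (congrArg _ (e₁ _ _ _ _ h' (hl β) (hr α))))

end Rigid

end Interchange

/-! ### Finiteness over the even part and Krull dimension -/

section RingTheory

variable {k : Type u₀} [Field k]

/-- A finitely generated algebra `R = A + O` with `A` a central subalgebra and `O * O ⊆ A` is
finite over `A`: the `O`-parts of algebra generators and `1` generate it as a module. -/
theorem finite_over_central_of_add_odd {R : Type w} [Ring R] [Algebra k R] (A : Subalgebra k R)
    (O : Set R) (hA : ∀ a ∈ A, ∀ x : R, a * x = x * a)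
    (hadd : ∀ x : R, ∃ a ∈ A, ∃ o ∈ O, x = a + o) (hO : ∀ x ∈ O, ∀ y ∈ O, x * y ∈ A)
    (hR : Algebra.FiniteType k R) : Module.Finite A R := by
  classical
  obtain ⟨s, hs⟩ := hR.out
  choose e he o ho heo using hadd
  let L : Submodule A R := Submodule.span A ((insert 1 (s.image o) : Finset R) : Set R)
  have h1 : (1 : R) ∈ L := Submodule.subset_span (by simp)
  have ho' : ∀ x ∈ s, o x ∈ L := fun x hx => Submodule.subset_span (by
    simp only [Finset.coe_insert, Finset.coe_image]
    exact Or.inr ⟨x, hx, rfl⟩)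
  have hmul : ∀ a ∈ A, ∀ y ∈ L, a * y ∈ L := fun a ha y hy => L.smul_mem ⟨a, ha⟩ hy
  have key : ∀ x ∈ Algebra.adjoin k (s : Set R), ∀ y ∈ L, x * y ∈ L := by
    intro x hx
    induction hx using Algebra.adjoin_induction with
    | mem x hx =>
      intro y hy
      rw [heo x, add_mul]
      refine L.add_mem (hmul _ (he x) y hy) ?_
      induction hy using Submodule.span_induction with
      | mem y hy =>
        simp only [Finset.coe_insert, Finset.coe_image] at hy
        rcases hy with rfl | ⟨z, _, rfl⟩
        · rw [mul_one]
          exact ho' x hx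
        · simpa using hmul _ (hO _ (ho x) _ (ho z)) 1 h1
      | zero => simp
      | add y z _ _ hy hz =>
        rw [mul_add]
        exact L.add_mem hy hz
      | smul a y _ hy =>
        have : o x * (a • y) = a • (o x * y) := by
          change o x * ((a : R) * y) = (a : R) * (o x * y)
          rw [← mul_assoc, ← hA a a.2, mul_assoc]
        rw [this]
        exact L.smul_mem a hy
    | algebraMap r => exact fun y hy => hmul _ (A.algebraMap_mem r) y hy
    | add x z _ _ hx hz =>
      intro y hy
      rw [add_mul]
      exact L.add_mem (hx y hy) (hz y hy)
    | mul x z _ _ hx hz =>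
      intro y hy
      rw [mul_assoc]
      exact hx _ (hz y hy)
  refine ⟨⟨_, (eq_top_iff.2 fun x _ => ?_ : L = ⊤)⟩⟩
  simpa using key x (hs ▸ Algebra.mem_top) 1 h1

/-- The Krull dimension does not increase along an integral map of commutative rings. -/
theorem ringKrullDim_le_of_isIntegral {A : Type w₁} {B : Type w₂} [CommRing A] [CommRing B]
    (g : A →+* B) (hg : g.IsIntegral) : ringKrullDim B ≤ ringKrullDim A := by
  let := g.toAlgebra
  have : Algebra.IsIntegral A B := ⟨hg⟩
  refine Order.krullDim_le_of_strictMono (fun P : PrimeSpectrum B => PrimeSpectrum.comap g P) ?_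
  intro P Q h
  exact Ideal.IsIntegral.comap_lt_comap (R := A) h

/-- Krull dimensions of commutative rings of central elements: `B ⊆ S` is integral over the image
of `A ⊆ R` as soon as `S` is finite over `A`. -/
theorem primeKrullDim_le_of_finite {R : Type w₁} {S : Type w₂} [Ring R] [Ring S] [Algebra k R]
    [Algebra k S] (f : R →ₐ[k] S) (A : Subalgebra k R) (B : Subalgebra k S)
    (hf : ∀ a ∈ A, f a ∈ B) (hA : ∀ a ∈ A, ∀ x : R, a * x = x * a)
    (hB : ∀ b ∈ B, ∀ x : S, b * x = x * b) (hAR : Module.Finite A R)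
    (hfin : IsFiniteRingHom f.toRingHom) : primeKrullDim B ≤ primeKrullDim A := by
  let cA : CommRing A :=
    { (inferInstance : Ring A) with mul_comm := fun a b => Subtype.ext (hA a a.2 b) }
  let cB : CommRing B :=
    { (inferInstance : Ring B) with mul_comm := fun a b => Subtype.ext (hB a a.2 b) }
  let algS : Algebra A S := ((f.toRingHom).comp A.val.toRingHom).toAlgebra'
    fun a x => hB _ (hf a a.2) x
  have hAS : Module.Finite A S := by
    let modS : Module R S := Module.compHom S f.toRingHom
    have : @IsScalarTower A R S _ _ algS.toSMul := ⟨fun a r s => by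
      change f (a * r) * s = f a * (f r * s)
      rw [map_mul, mul_assoc]⟩
    have hRS : Module.Finite R S := hfin
    exact @Module.Finite.trans A R S _ _ _ _ algS.toModule _ this hAR hRS
  let g : A →+* B := ((f.toRingHom).comp A.val.toRingHom).codRestrict B fun a => hf a a.2
  have hg : g.IsIntegral := by
    intro b
    obtain ⟨p, hp, hpb⟩ := IsIntegral.of_finite A (b : S)
    refine ⟨p, hp, Subtype.ext ?_⟩
    exact (Polynomial.hom_eval₂ p g B.val.toRingHom b).trans hpb
  have := ringKrullDim_le_of_isIntegral g hg
  rwa [← primeKrullDim_eq_ringKrullDim, ← primeKrullDim_eq_ringKrullDim] at this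

/-- An algebra finite (as a left module) over a finitely generated algebra is finitely
generated. -/
theorem finiteType_of_isFiniteRingHom {R : Type w₁} {S : Type w₂} [Ring R] [Ring S] [Algebra k R]
    [Algebra k S] (f : R →ₐ[k] S) (hR : Algebra.FiniteType k R)
    (hf : IsFiniteRingHom f.toRingHom) : Algebra.FiniteType k S := by
  classical
  let modS : Module R S := Module.compHom S f.toRingHom
  obtain ⟨s, hs⟩ := hR.out
  obtain ⟨t, ht⟩ := (show Module.Finite R S from hf).fg_top
  let U : Subalgebra k S := Algebra.adjoin k ((s.image f ∪ t : Finset S) : Set S)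
  have hfU : ∀ r : R, f r ∈ U := by
    intro r
    have hr : f r ∈ (Algebra.adjoin k (s : Set R)).map f := ⟨r, hs ▸ Algebra.mem_top, rfl⟩
    rw [AlgHom.map_adjoin] at hr
    exact Algebra.adjoin_mono (by simp) hr
  refine ⟨⟨_, (eq_top_iff.2 fun x _ => ?_ : U = ⊤)⟩⟩
  have hx : x ∈ Submodule.span R (t : Set S) := ht ▸ Submodule.mem_top
  induction hx using Submodule.span_induction with
  | mem y hy => exact Algebra.subset_adjoin (by simp [Finset.mem_coe.1 hy])
  | zero => exact U.zero_mem
  | add y z _ _ hy hz => exact U.add_mem (hy trivial) (hz trivial)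
  | smul r y _ hy => exact U.mul_mem (hfU r) (hy trivial)

theorem finite_of_finite_compHom {R : Type w₁} {S : Type w₂} [Ring R] [Ring S] {M : Type w₂}
     [AddCommGroup M] [Module S M] (f : R →+* S)
    (h : @Module.Finite R M _ _ (Module.compHom M f)) : Module.Finite S M := by
  let _ : Module R M := Module.compHom M f
  let _ : Module R S := Module.compHom S f
  have : IsScalarTower R S M := ⟨fun r s m => mul_smul (f r) s m⟩
  exact Module.Finite.of_restrictScalars_finite R S M

end RingTheory

/-! ### Projective covers and generators in finite linear categories -/

section FiniteLinear

variable {C : Type u} [Category.{v} C] [Abelian C]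

theorem nonempty_iso_biprod_of_retract {A X : C} (h : Retract A X) :
    ∃ B : C, Nonempty (X ≅ A ⊞ B) := by
  have : IsSplitMono h.i := IsSplitMono.mk' ⟨h.r, h.retract⟩
  exact ⟨cokernel h.i, ⟨biprod.uniqueUpToIso _ _
    (isBilimitBinaryBiconeOfIsSplitMonoOfCokernel (cokernelIsCokernel h.i))⟩⟩

/-- A nonzero noetherian object has a simple quotient. -/
theorem exists_simple_quotient {X : C} [IsNoetherianObject X] (hX : ¬ IsZero X) :
    ∃ (S : C) (p : X ⟶ S), Simple S ∧ Epi p := by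
  obtain ⟨U, hU, hmax⟩ := WellFounded.has_min
    (inferInstance : WellFoundedGT (Subobject X)).wf {U : Subobject X | ¬ Epi U.arrow}
    ⟨⊥, fun h => hX (by
      rw [IsZero.iff_id_eq_zero, ← cancel_epi (⊥ : Subobject X).arrow]
      simp)⟩
  refine ⟨cokernel U.arrow, cokernel.π _, ?_, inferInstance⟩
  have hne : cokernel.π U.arrow ≠ 0 := fun h => hU (Preadditive.epi_of_cokernel_zero h)
  refine simple_of_cosimple _ fun {Z} f _ => ⟨fun hf h0 => hne ?_, fun h0 => ?_⟩
  · rw [← cancel_mono f, h0, comp_zero, zero_comp]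
  · -- the kernel of `X ⟶ Z` contains `U` and is proper, so it is `U`
    have hle : U ≤ kernelSubobject (cokernel.π U.arrow ≫ f) :=
      le_kernelSubobject _ _ (by simp)
    have heq : kernelSubobject (cokernel.π U.arrow ≫ f) ≤ U := by
      by_contra hlt
      refine hmax _ (fun hepi => h0 ?_) (lt_of_le_not_ge hle hlt)
      rw [← cancel_epi (cokernel.π U.arrow),
        ← cancel_epi (kernelSubobject (cokernel.π U.arrow ≫ f)).arrow]
      simp
    have : Mono f := by
      refine Preadditive.mono_of_cancel_zero _ fun {T} t ht => ?_
      obtain ⟨T', e, _, s, hs⟩ := surjective_up_to_refinements_of_epi (cokernel.π U.arrow) t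
      have hs0 : s ≫ cokernel.π U.arrow ≫ f = 0 := by
        rw [← Category.assoc, ← hs, Category.assoc, ht, comp_zero]
      have hs1 : s ≫ cokernel.π U.arrow = 0 := by
        rw [← factorThruKernelSubobject_comp_arrow _ s hs0, ← Subobject.ofLE_arrow heq, Category.assoc,
          Category.assoc, cokernel.condition, comp_zero, comp_zero]
      rw [← cancel_epi e, hs, hs1, comp_zero]
    exact isIso_of_mono_of_epi f

/-- An epimorphic endomorphism of an object with finite dimensional endomorphism algebra is
invertible: precomposition with it is injective, hence surjective. -/
theorem isIso_of_epi_endomorphism (k : Type u₀) [Field k] [Linear k C] {X : C}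
    [Module.Finite k (X ⟶ X)] (f : X ⟶ X) [Epi f] :
    IsIso f := by
  have hinj : Function.Injective (Linear.leftComp k X f) := fun g h hgh =>
    (cancel_epi f).1 hgh
  obtain ⟨r, hr⟩ := LinearMap.surjective_of_injective hinj (𝟙 X)
  have : IsSplitMono f := IsSplitMono.mk' ⟨r, hr⟩
  exact isIso_of_mono_of_epi f

/-- An artinian projective object over `S` can be cut down to a projective cover of `S`. -/
theorem exists_projective_cover (k : Type u₀) [Field k] [Linear k C]
    [∀ X Y : C, Module.Finite k (X ⟶ Y)]
    {P S : C} [Projective P] [IsArtinianObject P] (p : P ⟶ S) [Epi p] :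
    ∃ (M : C) (q : M ⟶ S), Projective M ∧ Epi q ∧
      ∀ {Z : C} (h : Z ⟶ M), Epi (h ≫ q) → Epi h := by
  obtain ⟨U, hU, hmin⟩ := WellFounded.has_min
    (inferInstance : WellFoundedLT (Subobject P)).wf {U : Subobject P | Epi (U.arrow ≫ p)}
    ⟨⊤, (inferInstance : Epi ((⊤ : Subobject P).arrow ≫ p))⟩
  have hess : ∀ {Z : C} (h : Z ⟶ (U : C)), Epi (h ≫ U.arrow ≫ p) → Epi h := by
    intro Z h hh
    let V : Subobject P := Subobject.mk (Limits.image.ι h ≫ U.arrow)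
    have hVU : V ≤ U := Subobject.mk_le_of_comm (Limits.image.ι h) rfl
    have hV : Epi (V.arrow ≫ p) := by
      have h1 : h ≫ U.arrow ≫ p = (factorThruImage h ≫
          (Subobject.underlyingIso (Limits.image.ι h ≫ U.arrow)).inv) ≫ V.arrow ≫ p := by
        simp [V]
      rw [h1] at hh
      exact epi_of_epi (factorThruImage h ≫
        (Subobject.underlyingIso (Limits.image.ι h ≫ U.arrow)).inv) (V.arrow ≫ p)
    have hUV : U ≤ V := by
      by_contra hlt
      exact hmin V hV (lt_of_le_not_ge hVU hlt)
    let t : (U : C) ⟶ image h :=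
      Subobject.ofLE U V hUV ≫ (Subobject.underlyingIso (Limits.image.ι h ≫ U.arrow)).hom
    have ht : t ≫ Limits.image.ι h = 𝟙 _ := by
      rw [← cancel_mono U.arrow, Category.id_comp]
      simp [t, V]
    have : Epi (Limits.image.ι h) := by
      have : Epi (t ≫ Limits.image.ι h) := by rw [ht]; infer_instance
      exact epi_of_epi t _
    rw [← Limits.image.fac h]
    exact epi_comp _ _
  refine ⟨U, U.arrow ≫ p, ?_, hU, hess⟩
  have : Epi (U.arrow ≫ p) := hU
  let φ : P ⟶ (U : C) := Projective.factorThru p (U.arrow ≫ p)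
  have hφ : φ ≫ U.arrow ≫ p = p := Projective.factorThru_comp _ _
  have h1 : Epi (U.arrow ≫ φ) := hess _ (by rw [Category.assoc, hφ]; infer_instance)
  have h2 : IsIso (U.arrow ≫ φ) := isIso_of_epi_endomorphism k _
  exact Retract.projective (Y := P) ⟨U.arrow, φ ≫ inv (U.arrow ≫ φ), by
    rw [← Category.assoc, IsIso.hom_inv_id]⟩

/-- A projective object mapping onto `S` contains the projective cover of `S` as a summand. -/
theorem nonempty_iso_biprod_of_cover (k : Type u₀) [Field k] [Linear k C]
    [∀ X Y : C, Module.Finite k (X ⟶ Y)]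
    {M S X : C} [Projective M] [Projective X] (q : M ⟶ S) [Epi q]
    (hess : ∀ {Z : C} (h : Z ⟶ M), Epi (h ≫ q) → Epi h) (f : X ⟶ S) [Epi f] :
    ∃ B : C, Nonempty (X ≅ M ⊞ B) := by
  let a : M ⟶ X := Projective.factorThru q f
  let b : X ⟶ M := Projective.factorThru f q
  have hab : (a ≫ b) ≫ q = q := by
    rw [Category.assoc, Projective.factorThru_comp, Projective.factorThru_comp]
  have : Epi (a ≫ b) := hess _ (by rw [hab]; infer_instance)
  have : IsIso (a ≫ b) := isIso_of_epi_endomorphism k _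
  exact nonempty_iso_biprod_of_retract ⟨a, b ≫ inv (a ≫ b), by
    rw [← Category.assoc, IsIso.hom_inv_id]⟩

/-- In a finite linear category there are finitely many nonzero projective objects such that every
nonzero projective object has one of them as a direct summand. -/
theorem exists_finite_projective_summands (k : Type u₀) [Field k] [Linear k C]
    [∀ X Y : C, Module.Finite k (X ⟶ Y)] [EnoughProjectives C]
    (hlen : ∀ X : C, IsNoetherianObject X ∧ IsArtinianObject X)
    (hsimple : ∃ (n : ℕ) (S : Fin n → C), ∀ X : C, Simple X → ∃ i, Nonempty (X ≅ S i)) :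
    ∃ (ι : Type) (_ : Fintype ι) (M : ι → C), (∀ i, Projective (M i)) ∧ (∀ i, ¬ IsZero (M i)) ∧
      (∀ X : C, Projective X → ¬ IsZero X → ∃ (i : ι) (B : C), Nonempty (X ≅ M i ⊞ B)) ∧
      (∀ X : C, ¬ IsZero X → ∃ (i : ι) (f : M i ⟶ X), f ≠ 0) := by
  classical
  obtain ⟨n, S, hS⟩ := hsimple
  have hcover : ∀ i : Fin n, ∃ (M : C) (q : M ⟶ S i), Projective M ∧ Epi q ∧
      ∀ {Z : C} (h : Z ⟶ M), Epi (h ≫ q) → Epi h := fun i =>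
    have := (hlen (Projective.over (S i))).2
    exists_projective_cover k (Projective.π (S i))
  choose M q hM hq hess using hcover
  refine ⟨{i : Fin n // Simple (S i)}, inferInstance, fun i => M i, fun i => hM i,
    fun i h0 => ?_, fun X hX hX0 => ?_, fun X hX0 => ?_⟩
  · have := i.2
    have := hq i
    refine Simple.not_isZero (S i) (IsZero.of_epi_eq_zero (q i) ?_)
    exact h0.eq_of_src _ _
  · have := (hlen X).1
    obtain ⟨T, f, hT, hf⟩ := exists_simple_quotient hX0
    obtain ⟨i, ⟨e⟩⟩ := hS T hT
    have := hM i
    have := hq i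
    exact ⟨⟨i, Simple.of_iso e.symm⟩, nonempty_iso_biprod_of_cover k (q i) (hess i) (f ≫ e.hom)⟩
  · have := (hlen X).1
    obtain ⟨T, f, hT, hf⟩ := exists_simple_quotient hX0
    obtain ⟨i, ⟨e⟩⟩ := hS T hT
    have := hM i
    have := hq i
    have hSi : Simple (S i) := Simple.of_iso e.symm
    refine ⟨⟨i, hSi⟩, Projective.factorThru (q i) (f ≫ e.hom), fun h0 => ?_⟩
    have h1 := Projective.factorThru_comp (q i) (f ≫ e.hom)
    rw [h0, zero_comp] at h1
    exact Simple.not_isZero (S i) (IsZero.of_epi_eq_zero (q i) h1.symm)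

theorem exists_projective_generator (k : Type u₀) [Field k] [Linear k C]
    [∀ X Y : C, Module.Finite k (X ⟶ Y)] [EnoughProjectives C]
    (hlen : ∀ X : C, IsNoetherianObject X ∧ IsArtinianObject X)
    (hsimple : ∃ (n : ℕ) (S : Fin n → C), ∀ X : C, Simple X → ∃ i, Nonempty (X ≅ S i)) :
    ∃ Q : C, Projective Q ∧ ∀ Y : C, (∀ g : Q ⟶ Y, g = 0) → IsZero Y := by
  obtain ⟨ι, _, M, hM, -, -, hne⟩ := exists_finite_projective_summands k hlen hsimple
  have := HasFiniteBiproducts.of_hasFiniteProducts (C := C)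
  refine ⟨biproduct M, ⟨fun f e _ => ⟨biproduct.desc fun i =>
    Projective.factorThru (biproduct.ι M i ≫ f) e, by ext; simp⟩⟩, fun Y hY => ?_⟩
  by_contra h0
  obtain ⟨i, f, hf⟩ := hne Y h0
  apply hf
  have h1 : biproduct.ι M i ≫ biproduct.π M i ≫ f = 0 := by
    rw [hY (biproduct.π M i ≫ f), comp_zero]
  simpa using h1

/-- Every object is a quotient of a finite power of a projective generator; hence spaces of maps out
of its images under right exact functors are bounded by those for the generator. -/
theorem exists_finrank_hom_le (k : Type u₀) [Field k] [Linear k C]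
    [∀ X Y : C, Module.Finite k (X ⟶ Y)] {Q : C} [Projective Q]
    (hQ : ∀ Y : C, (∀ g : Q ⟶ Y, g = 0) → IsZero Y) (N : C) :
    ∃ r : ℕ, ∀ (G : C ⥤ C) [G.Additive] [G.PreservesEpimorphisms] (T : C),
      Module.finrank k (G.obj N ⟶ T) ≤ r * Module.finrank k (G.obj Q ⟶ T) := by
  have := HasFiniteBiproducts.of_hasFiniteProducts (C := C)
  let b := Module.finBasis k (Q ⟶ N)
  let p : biproduct (fun _ : Fin (Module.finrank k (Q ⟶ N)) => Q) ⟶ N := biproduct.desc b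
  have hp : Epi p := by
    refine Preadditive.epi_of_isZero_cokernel p (hQ _ fun g => ?_)
    rw [← Projective.factorThru_comp g (cokernel.π p)]
    rw [← b.sum_repr (Projective.factorThru g (cokernel.π p)), Preadditive.sum_comp]
    refine Finset.sum_eq_zero fun j _ => ?_
    rw [Linear.smul_comp, ← biproduct.ι_desc (fun j => b j) j, Category.assoc]
    change _ • (_ ≫ p ≫ cokernel.π p) = 0
    rw [cokernel.condition, comp_zero, smul_zero]
  refine ⟨Module.finrank k (Q ⟶ N), fun G _ _ T => ?_⟩
  let φ : (G.obj N ⟶ T) →ₗ[k] (Fin (Module.finrank k (Q ⟶ N)) → (G.obj Q ⟶ T)) :=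
    LinearMap.pi fun j => Linear.leftComp k T (G.map (b j))
  have hφ : Function.Injective φ := by
    rw [injective_iff_map_eq_zero]
    intro f hf
    have hf' : ∀ j, G.map (b j) ≫ f = 0 := fun j => congrFun hf j
    rw [← cancel_epi (G.map p), comp_zero, ← Category.id_comp p, ← biproduct.total,
      Preadditive.sum_comp, G.map_sum, Preadditive.sum_comp]
    refine Finset.sum_eq_zero fun j _ => ?_
    simp [p, hf']
  have := LinearMap.finrank_le_finrank_of_injective hφ
  rwa [Module.finrank_pi_fintype, Finset.sum_const, Finset.card_univ, Fintype.card_fin,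
    smul_eq_mul] at this

end FiniteLinear

/-! ### Projective objects in rigid categories -/

section Rigid

variable {C : Type u} [Category.{v} C] [Abelian C] [MonoidalCategory C] [RigidCategory C]

theorem projective_tensor_right (X : C) {P : C} (hP : Projective P) : Projective (X ⊗ P) :=
  (tensorLeftAdjunction (ᘁX) X).map_projective P hP

theorem projective_tensor_left {P : C} (hP : Projective P) (X : C) : Projective (P ⊗ X) :=
  (tensorRightAdjunction X Xᘁ).map_projective P hP

/-- Projective objects are injective: tensoring a short exact sequence with a projective object
splits it, and a duality retracts `Q ⊗ Qᘁ ⊗ Q` onto `Q`. -/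
theorem injective_of_projective [MonoidalPreadditive C] {Q : C} (hQ : Projective Q) :
    Injective Q where
  factors {Z' Z} f i _ := by
    have hS : (ShortComplex.mk i (cokernel.π i) (cokernel.condition i)).ShortExact :=
      { exact := ShortComplex.exact_cokernel i, mono_f := inferInstance, epi_g := inferInstance }
    have hS' := hS.map_of_exact (tensorLeft (Q ⊗ Qᘁ))
    have : Projective ((ShortComplex.mk i (cokernel.π i) (cokernel.condition i)).map
        (tensorLeft (Q ⊗ Qᘁ))).X₃ :=
      projective_tensor_left (projective_tensor_left hQ _) _
    let R : (Q ⊗ Qᘁ) ⊗ Z ⟶ (Q ⊗ Qᘁ) ⊗ Z' := hS'.splittingOfProjective.r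
    have hR : (Q ⊗ Qᘁ) ◁ i ≫ R = 𝟙 _ := hS'.splittingOfProjective.f_r
    refine ⟨(λ_ Z).inv ≫ η_ Q Qᘁ ▷ Z ≫ R ≫ (Q ⊗ Qᘁ) ◁ f ≫ (α_ _ _ _).hom ≫ Q ◁ ε_ Q Qᘁ ≫
      (ρ_ Q).hom, ?_⟩
    rw [leftUnitor_inv_naturality_assoc, whisker_exchange_assoc, reassoc_of% hR,
      ← whisker_exchange_assoc, ← leftUnitor_inv_naturality_assoc,
      ExactPairing.evaluation_coevaluation_assoc]
    simp

theorem evaluation_ne_zero [MonoidalPreadditive C] {X : C} (hX : ¬ IsZero X) :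
    ε_ X Xᘁ ≠ 0 := by
  intro h
  refine hX ((IsZero.iff_id_eq_zero X).2 ?_)
  have := ExactPairing.evaluation_coevaluation X Xᘁ
  rw [h, MonoidalPreadditive.whiskerLeft_zero, comp_zero, comp_zero] at this
  rw [← cancel_epi (λ_ X).hom, ← cancel_mono (ρ_ X).inv, Category.comp_id, ← this]
  simp

theorem epi_evaluation [MonoidalPreadditive C] [Simple (𝟙_ C)] {X : C} (hX : ¬ IsZero X) :
    Epi (ε_ X Xᘁ) :=
  epi_of_nonzero_to_simple (evaluation_ne_zero hX)

/-- The tensor product of nonzero objects is nonzero. -/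
theorem not_isZero_tensor [MonoidalPreadditive C] [Simple (𝟙_ C)] {X Y : C} (hX : ¬ IsZero X)
    (hY : ¬ IsZero Y) : ¬ IsZero (X ⊗ Y) := by
  intro h
  have := epi_evaluation hX
  have h1 : IsZero ((Xᘁ ⊗ X) ⊗ Y) :=
    ((tensorLeft Xᘁ).map_isZero h).of_iso (α_ _ _ _)
  have : Epi (ε_ X Xᘁ ▷ Y) := inferInstanceAs (Epi ((tensorRight Y).map (ε_ X Xᘁ)))
  exact hY ((IsZero.of_epi (ε_ X Xᘁ ▷ Y) h1).of_iso (λ_ Y).symm)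

/-- A projective object `P` is a retract of `P ⊗ (Xᘁ ⊗ X)` for every nonzero `X`. -/
theorem nonempty_retract_tensor [MonoidalPreadditive C] [Simple (𝟙_ C)] {X : C} (hX : ¬ IsZero X)
    (P : C) [Projective P] : Nonempty (Retract P (P ⊗ (Xᘁ ⊗ X))) := by
  have := epi_evaluation hX
  have : Epi (P ◁ ε_ X Xᘁ) := inferInstanceAs (Epi ((tensorLeft P).map (ε_ X Xᘁ)))
  exact ⟨⟨Projective.factorThru (𝟙 P) (P ◁ ε_ X Xᘁ ≫ (ρ_ P).hom), _,
    Projective.factorThru_comp _ _⟩⟩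

end Rigid

/-! ### Surjective tensor functors preserve projective objects -/

section Counting

variable (k : Type u₀) [Field k] {C : Type u} [Category.{v} C] [Abelian C] [Linear k C]

/-- Maps out of a binary direct sum, as a linear equivalence. -/
noncomputable def homEquivOfIsoBiprod {X A B : C} (e : X ≅ A ⊞ B) (T : C) :
    (X ⟶ T) ≃ₗ[k] (A ⟶ T) × (B ⟶ T) where
  toFun f := (biprod.inl ≫ e.inv ≫ f, biprod.inr ≫ e.inv ≫ f)
  map_add' f g := by simp
  map_smul' r f := by simp
  invFun p := e.hom ≫ biprod.desc p.1 p.2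
  left_inv f := by
    rw [← cancel_epi e.inv, e.inv_hom_id_assoc]
    ext <;> simp
  right_inv p := by simp

/-- The dimension of the space of maps `Y ⟶ T` that lift along `π`. -/
noncomputable def liftRank {T' T : C} (π : T' ⟶ T) (Y : C) : ℕ :=
  Module.finrank k (LinearMap.range (Linear.rightComp k Y π))

theorem liftRank_of_projective {T' T : C} (π : T' ⟶ T) [Epi π] {Y : C} (hY : Projective Y) :
    liftRank k π Y = Module.finrank k (Y ⟶ T) := by
  have : LinearMap.range (Linear.rightComp k Y π) = ⊤ :=
    LinearMap.range_eq_top.2 fun f => ⟨Projective.factorThru f π, Projective.factorThru_comp f π⟩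
  rw [liftRank, this, finrank_top]

variable [∀ X Y : C, Module.Finite k (X ⟶ Y)]

theorem finrank_hom_of_iso_biprod {X A B : C} (e : X ≅ A ⊞ B) (T : C) :
    Module.finrank k (X ⟶ T) = Module.finrank k (A ⟶ T) + Module.finrank k (B ⟶ T) := by
  rw [(homEquivOfIsoBiprod k e T).finrank_eq, Module.finrank_prod]

theorem finrank_hom_le_of_epi {X Y : C} (p : X ⟶ Y) [Epi p] (T : C) :
    Module.finrank k (Y ⟶ T) ≤ Module.finrank k (X ⟶ T) :=
  LinearMap.finrank_le_finrank_of_injective (f := Linear.leftComp k T p)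
    fun _ _ h => (cancel_epi p).1 h

theorem liftRank_le {T' T : C} (π : T' ⟶ T) (Y : C) :
    liftRank k π Y ≤ Module.finrank k (Y ⟶ T) :=
  Submodule.finrank_le _

theorem liftRank_lt {T' T : C} (π : T' ⟶ T) {Y : C} (f : Y ⟶ T)
    (hf : ∀ g : Y ⟶ T', g ≫ π ≠ f) : liftRank k π Y < Module.finrank k (Y ⟶ T) := by
  refine Submodule.finrank_lt fun h => ?_
  obtain ⟨g, hg⟩ := LinearMap.range_eq_top.1 h f
  exact hf g hg

theorem liftRank_of_iso_biprod {T' T : C} (π : T' ⟶ T) {X A B : C} (e : X ≅ A ⊞ B) :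
    liftRank k π X = liftRank k π A + liftRank k π B := by
  have hcomm : (homEquivOfIsoBiprod k e T).toLinearMap ∘ₗ Linear.rightComp k X π =
      ((Linear.rightComp k A π).prodMap (Linear.rightComp k B π)) ∘ₗ
        (homEquivOfIsoBiprod k e T').toLinearMap := by
    ext f <;> simp [homEquivOfIsoBiprod]
  have h1 := (homEquivOfIsoBiprod k e T).finrank_map_eq
    (LinearMap.range (Linear.rightComp k X π))
  have h2 : (LinearMap.range (Linear.rightComp k X π)).map
      (homEquivOfIsoBiprod k e T).toLinearMap =
      LinearMap.range ((LinearMap.range (Linear.rightComp k A π)).subtype.prodMap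
        (LinearMap.range (Linear.rightComp k B π)).subtype) := by
    rw [← LinearMap.range_comp, hcomm, LinearMap.range_comp, LinearEquiv.range, Submodule.map_top,
      LinearMap.range_prodMap, LinearMap.range_prodMap, Submodule.range_subtype,
      Submodule.range_subtype]
  have h3 := LinearMap.finrank_range_of_inj
    (f := (LinearMap.range (Linear.rightComp k A π)).subtype.prodMap
        (LinearMap.range (Linear.rightComp k B π)).subtype)
    (Function.Injective.prodMap Subtype.val_injective Subtype.val_injective)
  rw [Module.finrank_prod] at h3
  rw [liftRank, ← h1, h2, h3]
  rfl

theorem finrank_hom_congr {X Y : C} (e : X ≅ Y) (T : C) :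
    Module.finrank k (X ⟶ T) = Module.finrank k (Y ⟶ T) :=
  le_antisymm (finrank_hom_le_of_epi k e.inv T) (finrank_hom_le_of_epi k e.hom T)

end Counting

section TensorFunctor

variable {D : Type u₁} [Category.{v₁} D] [Abelian D] [MonoidalCategory D] [RigidCategory D]
  {C : Type u₂} [Category.{v₂} C] [Abelian C] [MonoidalCategory C] [RigidCategory C]

/-- If the image of one nonzero projective object is projective, then so is the image of every
projective object. -/
theorem projective_map_of_projective_map [MonoidalPreadditive D] [Simple (𝟙_ D)]
    (F : D ⥤ C) [F.Monoidal] {X : D} (hX : ¬ IsZero X) (hFX : Projective (F.obj X))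
    (P : D) [Projective P] : Projective (F.obj P) := by
  obtain ⟨ρ⟩ := nonempty_retract_tensor hX P
  have : Projective (F.obj (P ⊗ (Xᘁ ⊗ X))) :=
    Projective.of_iso (whiskerLeftIso (F.obj P) (Functor.Monoidal.μIso F _ _) ≪≫
      Functor.Monoidal.μIso F _ _)
      (projective_tensor_right _ (projective_tensor_right _ hFX))
  exact (ρ.map F).projective

/-- If `F` is surjective, every projective object of `C` is a summand of the image of a projective
object, because projective objects are injective. -/
theorem exists_iso_biprod_of_surjective {D : Type u₁} [Category.{v₁} D] [Abelian D]
    [EnoughProjectives D] [MonoidalPreadditive C] (F : D ⥤ C) [PreservesFiniteColimits F]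
    (hF : IsSurjectiveFunctor F) (Q : C) (hQ : Projective Q) :
    ∃ (P : D) (N : C), Projective P ∧ Nonempty (F.obj P ≅ Q ⊞ N) := by
  have : Injective Q := injective_of_projective hQ
  obtain ⟨X, S, i, p, _, _⟩ := hF Q
  let σ : Q ⟶ S := Projective.factorThru (𝟙 Q) p
  have hσ : σ ≫ p = 𝟙 Q := Projective.factorThru_comp _ _
  have : Mono σ := mono_of_mono_fac hσ
  let ψ : Q ⟶ F.obj (Projective.over X) := Projective.factorThru (σ ≫ i) (F.map (Projective.π X))
  have hψ : ψ ≫ F.map (Projective.π X) = σ ≫ i := Projective.factorThru_comp _ _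
  obtain ⟨N, hN⟩ := nonempty_iso_biprod_of_retract (A := Q) (X := F.obj (Projective.over X))
    ⟨ψ, F.map (Projective.π X) ≫ Injective.factorThru (𝟙 Q) (σ ≫ i), by
      rw [reassoc_of% hψ, ← Category.assoc, Injective.comp_factorThru]⟩
  exact ⟨_, N, inferInstance, hN⟩

/-- The decomposition of `X ⊗ Y` induced by `X ≅ A ⊞ B` and `Y ≅ A' ⊞ B'`, with the three summands
other than `B ⊗ B'` grouped as `A ⊗ Y` and `B ⊗ A'`. -/
noncomputable def tensorBiprodIso {C : Type u} [Category.{v} C] [Abelian C] [MonoidalCategory C]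
    [MonoidalPreadditive C] {X Y A B A' B' : C} (e : X ≅ A ⊞ B) (e' : Y ≅ A' ⊞ B') :
    X ⊗ Y ≅ ((A ⊗ Y) ⊞ (B ⊗ A')) ⊞ (B ⊗ B') :=
  haveI := preservesBinaryBiproducts_of_preservesBiproducts (tensorRight Y)
  haveI := preservesBinaryBiproducts_of_preservesBiproducts (tensorLeft B)
  whiskerRightIso e Y ≪≫ (tensorRight Y).mapBiprod A B ≪≫
    biprod.mapIso (Iso.refl _) (whiskerLeftIso B e' ≪≫ (tensorLeft B).mapBiprod A' B') ≪≫
    (biprod.associator _ _ _).symm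

end TensorFunctor

section Growth

variable (k : Type u₀) [Field k] {C : Type u} [Category.{v} C] [Abelian C] [Linear k C]
  [MonoidalCategory C] [MonoidalPreadditive C] [RigidCategory C]
  [∀ X Y : C, Module.Finite k (X ⟶ Y)]

/-- The step of the growth estimate: if `(A ⊞ B) ⊗ Y` is decomposed according to `Y ≅ A' ⊞ B'`, and
`A'` has at least `m / r` times the size of `B'`, then the complement of `B ⊗ B'` has at least
`(m + 1) / r` times the size of `B ⊗ B'`. -/
theorem growth_step {r m : ℕ} {A B A' B' Y T : C} (e' : Y ≅ A' ⊞ B')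
    (hr : ∀ (G : C ⥤ C) [G.Additive] [G.PreservesEpimorphisms] (T : C),
      Module.finrank k (G.obj B ⟶ T) ≤ r * Module.finrank k (G.obj A ⟶ T))
    (hm : ∀ W : C, m * Module.finrank k (W ⊗ B' ⟶ T) ≤ r * Module.finrank k (W ⊗ A' ⟶ T))
    (W : C) : (m + 1) * Module.finrank k (W ⊗ (B ⊗ B') ⟶ T) ≤
      r * Module.finrank k (W ⊗ ((A ⊗ Y) ⊞ (B ⊗ A')) ⟶ T) := by
  have := preservesBinaryBiproducts_of_preservesBiproducts (tensorLeft W)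
  have h1 : Module.finrank k (W ⊗ (B ⊗ B') ⟶ T) = Module.finrank k ((W ⊗ B) ⊗ B' ⟶ T) :=
    finrank_hom_congr k (α_ _ _ _).symm T
  have h2 := finrank_hom_of_iso_biprod k ((tensorLeft W).mapBiprod (A ⊗ Y) (B ⊗ A')) T
  have h3 : Module.finrank k (W ⊗ (B ⊗ A') ⟶ T) = Module.finrank k ((W ⊗ B) ⊗ A' ⟶ T) :=
    finrank_hom_congr k (α_ _ _ _).symm T
  have h4 : Module.finrank k ((W ⊗ A) ⊗ B' ⟶ T) ≤ Module.finrank k (W ⊗ (A ⊗ Y) ⟶ T) := by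
    have : Epi (e'.hom ≫ biprod.snd) := epi_comp _ _
    have : Epi ((W ⊗ A) ◁ (e'.hom ≫ biprod.snd)) :=
      inferInstanceAs (Epi ((tensorLeft (W ⊗ A)).map (e'.hom ≫ biprod.snd)))
    exact (finrank_hom_le_of_epi k ((W ⊗ A) ◁ (e'.hom ≫ biprod.snd)) T).trans
      (finrank_hom_congr k (α_ W A Y) T).le
  have h5 : Module.finrank k ((W ⊗ B) ⊗ B' ⟶ T) ≤ r * Module.finrank k ((W ⊗ A) ⊗ B' ⟶ T) :=
    hr (tensorLeft W ⋙ tensorRight B') T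
  have h6 := hm (W ⊗ B)
  dsimp at h2
  rw [h1, h2, h3]
  nlinarith

end Growth

/-- A surjective tensor functor between finite tensor categories preserves projective objects. -/
theorem projective_map_of_surjective (k : Type u₀) [Field k]
    {D : Type u₁} [Category.{v₁} D] [Abelian D] [Linear k D] [MonoidalCategory D]
    [MonoidalPreadditive D] [MonoidalLinear k D] [RigidCategory D] [IsFiniteTensorCategory k D]
    {C : Type u₂} [Category.{v₂} C] [Abelian C] [Linear k C] [MonoidalCategory C]
    [MonoidalPreadditive C] [MonoidalLinear k C] [RigidCategory C] [IsFiniteTensorCategory k C]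
    (F : D ⥤ C) [F.Monoidal] [F.Additive]
    [PreservesFiniteColimits F] (hF : IsSurjectiveFunctor F) (P₀ : D) [Projective P₀] :
    Projective (F.obj P₀) := by
  have : EnoughProjectives D := IsFiniteTensorCategory.enoughProjectives k
  have : EnoughProjectives C := IsFiniteTensorCategory.enoughProjectives k
  have : Simple (𝟙_ D) := IsFiniteTensorCategory.simple_unit k
  have : Simple (𝟙_ C) := IsFiniteTensorCategory.simple_unit k
  have : ∀ X Y : D, Module.Finite k (X ⟶ Y) := IsFiniteTensorCategory.finite_hom
  have : ∀ X Y : C, Module.Finite k (X ⟶ Y) := IsFiniteTensorCategory.finite_hom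
  have := HasFiniteBiproducts.of_hasFiniteProducts (C := C)
  have := HasFiniteBiproducts.of_hasFiniteProducts (C := D)
  have hFb := preservesBinaryBiproducts_of_preservesBinaryCoproducts F
  by_contra hP₀
  have hnp : ∀ X : D, ¬ IsZero X → ¬ Projective (F.obj X) := fun X hX hFX =>
    hP₀ (projective_map_of_projective_map F hX hFX P₀)
  obtain ⟨ι, _, M, hM, hM0, hsum, -⟩ := exists_finite_projective_summands (C := D) k
    (IsFiniteTensorCategory.finite_length k) (IsFiniteTensorCategory.finite_simples k)
  -- `T` detects that the objects `F (M i)` are not projective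
  let T : C := biproduct fun i => F.obj (M i)
  let π := Projective.π T
  have hlt : ∀ i, liftRank k π (F.obj (M i)) < Module.finrank k (F.obj (M i) ⟶ T) := fun i =>
    liftRank_lt k π (biproduct.ι (fun i => F.obj (M i)) i) fun g hg => hnp _ (hM0 i)
      (Retract.projective (Y := Projective.over T) ⟨g, π ≫ biproduct.π _ i, by
        rw [reassoc_of% hg, biproduct.ι_π_self]⟩)
  let c : ℕ := ∑ i, Module.finrank k (F.obj (M i) ⟶ T)
  have hFiso : ∀ {X A B : D}, (X ≅ A ⊞ B) → (F.obj X ≅ F.obj A ⊞ F.obj B) := fun e =>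
    F.mapIso e ≪≫ F.mapBiprod _ _
  have hc : ∀ (n : ℕ) (X : D), Projective X → Module.finrank k (X ⟶ biproduct M) = n →
      Module.finrank k (F.obj X ⟶ T) + c * liftRank k π (F.obj X) ≤
        c * Module.finrank k (F.obj X ⟶ T) := by
    intro n
    induction n using Nat.strong_induction_on with
    | _ n ih =>
      intro X hX hn
      by_cases hX0 : IsZero X
      · have h0 : Module.finrank k (F.obj X ⟶ T) = 0 := by
          have : Subsingleton (F.obj X ⟶ T) := ⟨fun f g => (F.map_isZero hX0).eq_of_src f g⟩
          exact Module.finrank_zero_of_subsingleton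
        have := liftRank_le k π (F.obj X)
        simp_all
      · obtain ⟨i, B, ⟨e⟩⟩ := hsum X hX hX0
        have hB : Projective B := Retract.projective (Y := X) ⟨biprod.inr ≫ e.inv,
          e.hom ≫ biprod.snd, by simp⟩
        have h1 := finrank_hom_of_iso_biprod k e (biproduct M)
        have h2 : 0 < Module.finrank k (M i ⟶ biproduct M) := by
          have : Nontrivial (M i ⟶ biproduct M) := ⟨biproduct.ι M i, 0, fun h => hM0 i (by
            rw [IsZero.iff_id_eq_zero, ← biproduct.ι_π_self M i, h, zero_comp])⟩
          exact Module.finrank_pos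
        have h3 := ih _ (by omega) B hB rfl
        rw [finrank_hom_of_iso_biprod k (hFiso e), liftRank_of_iso_biprod k π (hFiso e)]
        have h4 := hlt i
        have h5 : Module.finrank k (F.obj (M i) ⟶ T) ≤ c :=
          Finset.single_le_sum (f := fun i => Module.finrank k (F.obj (M i) ⟶ T))
            (fun _ _ => Nat.zero_le _) (Finset.mem_univ i)
        nlinarith
  obtain ⟨Q, hQ, hQgen⟩ := exists_projective_generator (C := C) k
    (IsFiniteTensorCategory.finite_length k) (IsFiniteTensorCategory.finite_simples k)
  obtain ⟨P, N, hP, ⟨eP⟩⟩ := exists_iso_biprod_of_surjective F hF Q hQ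
  obtain ⟨r, hr⟩ := exists_finrank_hom_le k hQgen N
  have hP0 : ¬ IsZero P := by
    intro h
    have hQ0 : IsZero Q := IsZero.of_mono (biprod.inl ≫ eP.inv) (F.map_isZero h)
    exact Simple.not_isZero (𝟙_ C) (hQgen _ fun g => hQ0.eq_of_src _ _)
  -- tensor powers of `P`: the projective summand outgrows the rest
  have hgrow : ∀ m : ℕ, ∃ (X : D) (Q' N' : C), Projective X ∧ ¬ IsZero X ∧ Projective Q' ∧
      Nonempty (F.obj X ≅ Q' ⊞ N') ∧ ∀ W : C, m * Module.finrank k (W ⊗ N' ⟶ T) ≤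
        r * Module.finrank k (W ⊗ Q' ⟶ T) := by
    intro m
    induction m with
    | zero => exact ⟨P, Q, N, hP, hP0, hQ, ⟨eP⟩, fun W => by simp⟩
    | succ m ih =>
      obtain ⟨X, Q', N', hX, hX0, hQ', ⟨e⟩, hm⟩ := ih
      have h1 : Projective (Q ⊗ F.obj X) := projective_tensor_left hQ _
      have h2 : Projective (N ⊗ Q') := projective_tensor_right N hQ'
      exact ⟨P ⊗ X, _, N ⊗ N', projective_tensor_left hP X, not_isZero_tensor hP0 hX0,
        inferInstance, ⟨(Functor.Monoidal.μIso F P X).symm ≪≫ tensorBiprodIso eP e⟩,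
        growth_step k e hr hm⟩
  obtain ⟨X, Q', N', hX, hX0, hQ', ⟨e⟩, hm⟩ := hgrow (r * c + 1)
  have h1 := hm (𝟙_ C)
  rw [finrank_hom_congr k (λ_ N'), finrank_hom_congr k (λ_ Q')] at h1
  have h2 := finrank_hom_of_iso_biprod k e T
  have h3 := liftRank_of_iso_biprod k π e
  have h4 := liftRank_of_projective k π hQ'
  have h5 := hc _ X hX rfl
  have h6 : 0 < Module.finrank k (F.obj X ⟶ T) := by
    obtain ⟨i, B, ⟨e'⟩⟩ := hsum X hX hX0
    have := finrank_hom_of_iso_biprod k (hFiso e') T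
    have := hlt i
    omega
  have h7 : Module.finrank k (F.obj X ⟶ T) ≤ c * Module.finrank k (N' ⟶ T) := by
    nlinarith
  have h8 : r * Module.finrank k (Q' ⟶ T) ≤ r * (c * Module.finrank k (N' ⟶ T)) :=
    Nat.mul_le_mul_left r (by omega)
  have h9 : Module.finrank k (N' ⟶ T) = 0 := by nlinarith
  rw [h9] at h7
  omega

/-! ### Representability of `X ↦ Hom(F X, V)` -/

section Representability

variable {D : Type u₁} [Category.{v₁} D] [Abelian D] {C : Type u₂} [Category.{v₂} C] [Abelian C]
  (F : D ⥤ C) [F.Additive] [PreservesFiniteColimits F]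

/-- A map `x : F X ⟶ V` is reduced if it is killed by no nonzero map into `X`; equivalently, it does
not factor through the image of a proper quotient of `X`. -/
def IsReducedMap {X : D} {V : C} (x : F.obj X ⟶ V) : Prop :=
  ∀ ⦃K : D⦄ (f : K ⟶ X), F.map f ≫ x = 0 → f = 0

theorem exists_isReducedMap {X : D} [IsNoetherianObject X] {V : C} (x : F.obj X ⟶ V) :
    ∃ (Z : D) (q : X ⟶ Z) (z : F.obj Z ⟶ V), F.map q ≫ z = x ∧ IsReducedMap F z := by
  obtain ⟨U, hU, hmax⟩ := WellFounded.has_min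
    (inferInstance : WellFoundedGT (Subobject X)).wf {U : Subobject X | F.map U.arrow ≫ x = 0}
    ⟨⊥, by simp⟩
  have hq : IsColimit (CokernelCofork.ofπ (F.map (cokernel.π U.arrow))
      (by rw [← F.map_comp, cokernel.condition, F.map_zero]) : CokernelCofork (F.map U.arrow)) :=
    isColimitCoforkMapOfIsColimit' F (cokernel.condition U.arrow) (cokernelIsCokernel U.arrow)
  obtain ⟨z, hz⟩ := CokernelCofork.IsColimit.desc' hq x hU
  replace hz : F.map (cokernel.π U.arrow) ≫ z = x := hz
  refine ⟨cokernel U.arrow, cokernel.π _, z, hz, fun L f hf => ?_⟩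
  -- the image in `X` of the pullback of `f` still kills `x`, so it lies in `U`
  let s : pullback f (cokernel.π U.arrow) ⟶ X := pullback.snd _ _
  have hs : F.map s ≫ x = 0 := by
    rw [← hz, ← Category.assoc, ← F.map_comp, ← pullback.condition, F.map_comp, Category.assoc, hf,
      comp_zero]
  have hI : F.map (imageSubobject s).arrow ≫ x = 0 := by
    rw [← cancel_epi (F.map (factorThruImageSubobject s)), ← Category.assoc, ← F.map_comp,
      imageSubobject_arrow_comp, hs, comp_zero]
  have hle : U ≤ imageSubobject s := by
    refine Subobject.le_of_comm (pullback.lift 0 U.arrow (by simp) ≫ factorThruImageSubobject s) ?_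
    rw [Category.assoc, imageSubobject_arrow_comp, pullback.lift_snd]
  have hge : imageSubobject s ≤ U := by
    by_contra hlt
    exact hmax _ hI (lt_of_le_not_ge hle hlt)
  have hs0 : s ≫ cokernel.π U.arrow = 0 := by
    rw [← imageSubobject_arrow_comp s, ← Subobject.ofLE_arrow hge, Category.assoc, Category.assoc,
      cokernel.condition, comp_zero, comp_zero]
  rw [← cancel_epi (pullback.fst f (cokernel.π U.arrow)), pullback.condition, comp_zero]
  exact hs0

/-- Over a finite linear category the functor `X ↦ Hom(F X, V)` has a universal element: a reduced
map `F J ⟶ V` with `dim Hom(Q, J)` maximal for a projective generator `Q`. Only the existence half of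
its universal property is recorded. -/
theorem exists_universal_map (k : Type u₀) [Field k] [Linear k D] [Linear k C] [F.Linear k]
    [∀ X Y : D, Module.Finite k (X ⟶ Y)] [∀ X Y : C, Module.Finite k (X ⟶ Y)]
    [∀ X : D, IsNoetherianObject X] {Q : D} [Projective Q]
    (hQ : ∀ Y : D, (∀ g : Q ⟶ Y, g = 0) → IsZero Y) (V : C) :
    ∃ (J : D) (x : F.obj J ⟶ V), ∀ (X : D) (y : F.obj X ⟶ V), ∃ f : X ⟶ J, F.map f ≫ x = y := by
  have hbound : ∀ (X : D) (x : F.obj X ⟶ V), IsReducedMap F x →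
      Module.finrank k (Q ⟶ X) ≤ Module.finrank k (F.obj Q ⟶ V) := by
    intro X x hx
    refine LinearMap.finrank_le_finrank_of_injective
      (f := (Linear.rightComp k (F.obj Q) x) ∘ₗ F.mapLinearMap k) ?_
    rw [injective_iff_map_eq_zero]
    exact fun f hf => hx f hf
  let s : Set ℕ := {n | ∃ (X : D) (x : F.obj X ⟶ V), IsReducedMap F x ∧
    Module.finrank k (Q ⟶ X) = n}
  have hs : s.Nonempty := by
    obtain ⟨Z, -, z, -, hz⟩ := exists_isReducedMap F (X := Q) (0 : F.obj Q ⟶ V)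
    exact ⟨_, Z, z, hz, rfl⟩
  have hbdd : BddAbove s := ⟨Module.finrank k (F.obj Q ⟶ V), by
    rintro _ ⟨X, x, hx, rfl⟩
    exact hbound X x hx⟩
  obtain ⟨J, x, hx, hJ⟩ := Nat.sSup_mem hs hbdd
  refine ⟨J, x, fun Y y => ?_⟩
  -- compare `J` with a reduced quotient of `J ⊞ Y`
  obtain ⟨Z, q, z, hz, hred⟩ := exists_isReducedMap F (X := J ⊞ Y)
    (F.map biprod.fst ≫ x + F.map biprod.snd ≫ y)
  let i : J ⟶ Z := biprod.inl ≫ q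
  have hi : F.map i ≫ z = x := by
    simp only [i, F.map_comp, Category.assoc, hz, Preadditive.comp_add]
    simp only [← Category.assoc, ← F.map_comp]
    simp
  have hy : F.map (biprod.inr ≫ q) ≫ z = y := by
    simp only [F.map_comp, Category.assoc, hz, Preadditive.comp_add]
    simp only [← Category.assoc, ← F.map_comp]
    simp
  have : Mono i := Preadditive.mono_of_cancel_zero _ fun f hf => hx f (by
    rw [← hi, ← Category.assoc, ← F.map_comp, hf, F.map_zero, zero_comp])
  have hinj : Function.Injective (Linear.rightComp k Q i) := fun f g h => (cancel_mono i).1 h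
  have hdim : Module.finrank k (Q ⟶ J) = Module.finrank k (Q ⟶ Z) :=
    le_antisymm (LinearMap.finrank_le_finrank_of_injective hinj)
      (hJ ▸ le_csSup hbdd ⟨Z, z, hred, rfl⟩)
  have hsurj : Function.Surjective (Linear.rightComp k Q i) :=
    (LinearMap.injective_iff_surjective_of_finrank_eq_finrank hdim).1 hinj
  have : Epi i := by
    refine Preadditive.epi_of_isZero_cokernel i (hQ _ fun g => ?_)
    obtain ⟨h, hh⟩ := hsurj (Projective.factorThru g (cokernel.π i))
    rw [← Projective.factorThru_comp g (cokernel.π i), ← hh]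
    simp
  have : IsIso i := isIso_of_mono_of_epi i
  refine ⟨(biprod.inr ≫ q) ≫ inv i, ?_⟩
  rw [F.map_comp, Category.assoc, ← hy, ← hi, ← Category.assoc (F.map (inv i)), ← F.map_comp,
    IsIso.inv_hom_id, F.map_id, Category.id_comp]

end Representability

/-! ### Transfer of cohomology along `F` -/

section Even

variable {C : Type u} [Category.{v} C] [Abelian C] [HasExt.{w} C]

theorem of_smul_of {X V : C} {a b : ℕ} (α : Ext.{w} X X a) (β : Ext.{w} X V b) :
    (DirectSum.of (ExtFam X X) a α) • (DirectSum.of (ExtFam X V) b β) =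
      DirectSum.of (ExtFam X V) (a + b) (α.comp β rfl) :=
  DirectSum.Gmodule.of_smul_of _ _ α β

theorem of_mul_of {X : C} {a b : ℕ} (α : Ext.{w} X X a) (β : Ext.{w} X X b) :
    (DirectSum.of (ExtFam X X) a α) * (DirectSum.of (ExtFam X X) b β) =
      DirectSum.of (ExtFam X X) (a + b) (α.comp β rfl) :=
  DirectSum.of_mul_of α β

/-- The graded module structure of `Ext^•(X, X)` over itself is the one given by its
multiplication. -/
theorem extTotal_module_self (X : C) :
    DirectSum.Gmodule.module (ExtFam X X) (ExtFam X X) =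
      (Semiring.toModule : Module (ExtTotal.{w} X X) (ExtTotal.{w} X X)) := by
  have h : DirectSum.Gmodule.smulAddMonoidHom (ExtFam X X) (ExtFam X X) =
      (AddMonoidHom.mul : ExtTotal.{w} X X →+ _) := by
    ext i α j β : 4
    exact (DirectSum.Gmodule.smulAddMonoidHom_apply_of_of _ _ α β).trans (of_mul_of α β).symm
  exact Module.ext' _ _ fun a b => DFunLike.congr_fun (DFunLike.congr_fun h a) b

variable [MonoidalCategory C] [MonoidalPreadditive C] [RigidCategory C] [EnoughProjectives C]
  (k : Type u₀) [Field k] [Linear k C]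

/-- Even cohomology classes are central, by graded commutativity. -/
theorem evenSubalgebra_central (a : Cohomology.{w} (𝟙_ C)) (ha : a ∈ evenSubalgebra k (𝟙_ C))
    (x : Cohomology.{w} (𝟙_ C)) : a * x = x * a := by
  classical
  rw [← DirectSum.sum_support_of a, Finset.sum_mul, Finset.mul_sum]
  refine Finset.sum_congr rfl fun n _ => ?_
  rcases Nat.even_or_odd n with hn | hn
  · induction x using DirectSum.induction_on with
    | zero => simp
    | add x y hx hy => rw [mul_add, add_mul, hx, hy]
    | of m β =>
      rw [of_mul_of, of_mul_of]
      have h := ext_unit_comp_comm (a n) β rfl (add_comm m n)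
      rw [Even.neg_one_pow (hn.mul_right m), one_smul] at h
      rw [h]
      exact DirectSum.of_eq_of_gradedMonoid_eq (gradedMk_comp _ _ _ _)
  · rw [ha n hn]
    simp

/-- Every cohomology class is the sum of an even and an odd one, and products of two odd classes are
even; so a finitely generated cohomology algebra is finite over its even part. -/
theorem finite_evenSubalgebra (h : Algebra.FiniteType k (Cohomology.{w} (𝟙_ C))) :
    Module.Finite (evenSubalgebra.{w} k (𝟙_ C)) (Cohomology.{w} (𝟙_ C)) := by
  classical
  refine finite_over_central_of_add_odd _ {x | ∀ n : ℕ, Even n → x n = 0}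
    (evenSubalgebra_central k) (fun x => ?_) (fun x hx y hy n hn => ?_) h
  · induction x using DirectSum.induction_on with
    | zero => exact ⟨0, zero_mem _, 0, fun _ _ => rfl, by simp⟩
    | add x y hx hy =>
      obtain ⟨a, ha, o, ho, rfl⟩ := hx
      obtain ⟨a', ha', o', ho', rfl⟩ := hy
      exact ⟨a + a', add_mem ha ha', o + o', fun n hn => by
        rw [DirectSum.add_apply, ho n hn, ho' n hn, add_zero], by abel⟩
    | of m β =>
      rcases Nat.even_or_odd m with hm | hm
      · refine ⟨_, fun n hn => DirectSum.of_eq_of_ne _ _ _ ?_, 0, fun _ _ => rfl, (add_zero _).symm⟩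
        rintro rfl
        exact Nat.not_even_iff_odd.2 hn hm
      · refine ⟨0, zero_mem _, _, fun n hn => DirectSum.of_eq_of_ne _ _ _ ?_, (zero_add _).symm⟩
        rintro rfl
        exact Nat.not_even_iff_odd.2 hm hn
  · rw [DirectSum.mul_eq_sum_support_ghas_mul, DFinsupp.finsetSum_apply]
    refine Finset.sum_eq_zero fun p _ => ?_
    by_cases hp : p.1 + p.2 = n
    · subst hp
      have h0 : (GradedMonoid.GMul.mul (x p.1) (y p.2) :
          ExtFam (𝟙_ C) (𝟙_ C) (p.1 + p.2)) = 0 := by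
        rcases Nat.even_or_odd p.1 with h1 | h1
        · rw [hx p.1 h1]
          exact DirectSum.GNonUnitalNonAssocSemiring.zero_mul _
        · rw [hy p.2 ((Nat.odd_add.1 hn).1 h1)]
          exact DirectSum.GNonUnitalNonAssocSemiring.mul_zero _
      rw [h0, map_zero]
      rfl
    · exact DirectSum.of_eq_of_ne _ _ _ (Ne.symm hp)

end Even

section Lift

variable {D : Type u₁} [Category.{v₁} D] [Abelian D] [EnoughProjectives D] [HasExt.{w₁} D]
  {C : Type u₂} [Category.{v₂} C] [Abelian C] [HasExt.{w₂} C]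

/-- If `F` is exact and preserves projective objects, a map `x : F J ⟶ V` through which all maps
`F X ⟶ V` factor has the same property for extension classes, by dimension shifting. -/
theorem exists_mapExactFunctor_comp (F : D ⥤ C) [F.Additive] [PreservesFiniteLimits F]
    [PreservesFiniteColimits F] (hP : ∀ P : D, Projective P → Projective (F.obj P))
    {J : D} {V : C} (x : F.obj J ⟶ V)
    (hx : ∀ (X : D) (y : F.obj X ⟶ V), ∃ f : X ⟶ J, F.map f ≫ x = y)
    {n : ℕ} {X : D} (y : Ext.{w₂} (F.obj X) V n) :
    ∃ α : Ext.{w₁} X J n, (α.mapExactFunctor F).comp (Ext.mk₀ x) (add_zero n) = y := by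
  induction n generalizing X with
  | zero =>
    obtain ⟨g, rfl⟩ := (Ext.mk₀_bijective _ _).2 y
    obtain ⟨f, rfl⟩ := hx X g
    exact ⟨Ext.mk₀ f, by rw [Ext.mapExactFunctor_mk₀, Ext.mk₀_comp_mk₀]⟩
  | succ n ih =>
    let p := Projective.π X
    have hS : (ShortComplex.mk (kernel.ι p) p (kernel.condition p)).ShortExact :=
      { exact := ShortComplex.exact_kernel p, mono_f := inferInstance, epi_g := inferInstance }
    have hFP : Projective (F.obj (Projective.over X)) := hP _ inferInstance
    obtain ⟨y', hy'⟩ := Ext.contravariant_sequence_exact₃ (hS.map_of_exact F) V y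
      (Ext.eq_zero_of_projective (P := F.obj (Projective.over X)) _) (add_comm 1 n)
    obtain ⟨α, hα⟩ := ih y'
    refine ⟨hS.extClass.comp α (add_comm 1 n), ?_⟩
    rw [Ext.mapExactFunctor_comp, Ext.mapExactFunctor_extClass, ← hy', ← hα]
    exact Ext.comp_assoc_of_third_deg_zero _ _ _ _

end Lift

section Transfer

theorem toAlgebra_of {k : Type u₀} [CommSemiring k] {A : ℕ → Type w₁} {B : Type w₂}
    [∀ i, AddCommMonoid (A i)] [∀ i, Module k (A i)] [DirectSum.GSemiring A] [Semiring B]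
    [DirectSum.GAlgebra k A] [Algebra k B] (f : ∀ i, A i →ₗ[k] B)
    (hone : f _ GradedMonoid.GOne.one = 1)
    (hmul : ∀ {i j} (ai : A i) (aj : A j), f _ (GradedMonoid.GMul.mul ai aj) = f _ ai * f _ aj)
    (i : ℕ) (a : A i) : DirectSum.toAlgebra k A f hone @hmul (DirectSum.of A i a) = f i a :=
  DirectSum.toSemiring_of _ hone @hmul i a

variable (k : Type u₀) [Field k]
  {D : Type u₁} [Category.{v₁} D] [Abelian D] [Linear k D] [MonoidalCategory D] [HasExt.{w₁} D]
  {C : Type u₂} [Category.{v₂} C] [Abelian C] [Linear k C] [MonoidalCategory C] [HasExt.{w₂} C]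
  (F : D ⥤ C) [F.Monoidal] [F.Additive] [F.Linear k] [PreservesFiniteLimits F]
  [PreservesFiniteColimits F]

theorem cohomologyMap_of {n : ℕ} (α : Ext.{w₁} (𝟙_ D) (𝟙_ D) n) :
    cohomologyMap.{w₂} k F (DirectSum.of (ExtFam (𝟙_ D) (𝟙_ D)) n α) =
      DirectSum.of (ExtFam (𝟙_ C) (𝟙_ C)) n
        ((Ext.mk₀ (Functor.Monoidal.εIso F).hom).comp ((α.mapExactFunctor F).comp
          (Ext.mk₀ (Functor.Monoidal.εIso F).inv) (add_zero n)) (zero_add n)) := by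
  apply toAlgebra_of

theorem cohomologyMap_mem_evenSubalgebra (a : Cohomology.{w₁} (𝟙_ D))
    (ha : a ∈ evenSubalgebra k (𝟙_ D)) :
    cohomologyMap.{w₂} k F a ∈ evenSubalgebra k (𝟙_ C) := by
  classical
  rw [← DirectSum.sum_support_of a, map_sum]
  refine sum_mem fun n _ => ?_
  rcases Nat.even_or_odd n with hn | hn
  · rw [cohomologyMap_of]
    refine fun m hm => DirectSum.of_eq_of_ne _ _ _ ?_
    rintro rfl
    exact Nat.not_even_iff_odd.2 hm hn
  · rw [ha n hn, map_zero, map_zero]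
    exact zero_mem _

variable {J : D} {V : C}

/-- The map `H^•(D, J) ⟶ H^•(C, V)` induced by `F` and a map `x : F J ⟶ V`. -/
noncomputable def cohomologyTransfer (x : F.obj J ⟶ V) :
    Cohomology.{w₁} J →+ Cohomology.{w₂} V :=
  DirectSum.toAddMonoid fun n => (DirectSum.of (ExtFam (𝟙_ C) V) n).comp
    (((Ext.mk₀ (Functor.Monoidal.εIso F).hom).precomp V (zero_add n)).comp
      (((Ext.mk₀ x).postcomp (F.obj (𝟙_ D)) (add_zero n)).comp (F.mapExtAddHom (𝟙_ D) J n)))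

omit [Linear k D] [Linear k C] [F.Linear k] in
theorem cohomologyTransfer_of (x : F.obj J ⟶ V) {n : ℕ} (β : Ext.{w₁} (𝟙_ D) J n) :
    cohomologyTransfer.{w₁, w₂} F x (DirectSum.of (ExtFam (𝟙_ D) J) n β) =
      DirectSum.of (ExtFam (𝟙_ C) V) n
        ((Ext.mk₀ (Functor.Monoidal.εIso F).hom).comp ((β.mapExactFunctor F).comp
          (Ext.mk₀ x) (add_zero n)) (zero_add n)) :=
  DirectSum.toAddMonoid_of _ _ _

theorem cohomologyTransfer_smul (x : F.obj J ⟶ V) (a : Cohomology.{w₁} (𝟙_ D))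
    (b : Cohomology.{w₁} J) :
    cohomologyTransfer.{w₁, w₂} F x (a • b) =
      cohomologyMap.{w₂} k F a • cohomologyTransfer.{w₁, w₂} F x b := by
  induction a using DirectSum.induction_on with
  | zero => simp
  | add a a' ha ha' => simp only [add_smul, map_add, ha, ha']
  | of i α =>
    induction b using DirectSum.induction_on with
    | zero => simp
    | add b b' hb hb' => simp only [smul_add, map_add, hb, hb']
    | of j β =>
      rw [of_smul_of, cohomologyTransfer_of, cohomologyMap_of, cohomologyTransfer_of, of_smul_of]
      congr 1
      rw [Ext.mapExactFunctor_comp, Ext.comp_assoc_of_third_deg_zero,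
        ← Ext.comp_assoc_of_third_deg_zero _ _ _ (zero_add i), Ext.comp_assoc_of_second_deg_zero,
        Ext.mk₀_comp_mk₀_assoc, Iso.inv_hom_id, Ext.mk₀_id_comp]
      exact (Ext.comp_assoc _ _ _ _ _ (by omega)).symm

omit [Linear k D] [Linear k C] [F.Linear k] in
theorem cohomologyTransfer_surjective [EnoughProjectives D]
    (hP : ∀ P : D, Projective P → Projective (F.obj P)) (x : F.obj J ⟶ V)
    (hx : ∀ (X : D) (y : F.obj X ⟶ V), ∃ f : X ⟶ J, F.map f ≫ x = y) :
    Function.Surjective (cohomologyTransfer.{w₁, w₂} F x) := by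
  intro y
  induction y using DirectSum.induction_on with
  | zero => exact ⟨0, map_zero _⟩
  | add y y' hy hy' =>
    obtain ⟨b, rfl⟩ := hy
    obtain ⟨b', rfl⟩ := hy'
    exact ⟨b + b', map_add _ _ _⟩
  | of n γ =>
    obtain ⟨β, hβ⟩ := exists_mapExactFunctor_comp.{w₁, w₂} F hP x hx
      ((Ext.mk₀ (Functor.Monoidal.εIso F).inv).comp γ (zero_add n))
    refine ⟨DirectSum.of (ExtFam (𝟙_ D) J) n β, ?_⟩
    rw [cohomologyTransfer_of, hβ, Ext.mk₀_comp_mk₀_assoc, Iso.hom_inv_id, Ext.mk₀_id_comp]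

/-- If `H^•(D, J)` is finite over `H^•(D, 𝟙)` then so is its image `H^•(C, V)`. -/
theorem finite_cohomology_of_universal_map [EnoughProjectives D]
    (hP : ∀ P : D, Projective P → Projective (F.obj P)) (x : F.obj J ⟶ V)
    (hx : ∀ (X : D) (y : F.obj X ⟶ V), ∃ f : X ⟶ J, F.map f ≫ x = y)
    (hJ : Module.Finite (Cohomology.{w₁} (𝟙_ D)) (Cohomology.{w₁} J)) :
    @Module.Finite (Cohomology.{w₁} (𝟙_ D)) (Cohomology.{w₂} V) _ _
      (Module.compHom _ (cohomologyMap.{w₂} k F).toRingHom) := by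
  let _ : Module (Cohomology.{w₁} (𝟙_ D)) (Cohomology.{w₂} V) :=
    Module.compHom _ (cohomologyMap.{w₂} k F).toRingHom
  let Ψ : Cohomology.{w₁} J →ₗ[Cohomology.{w₁} (𝟙_ D)] Cohomology.{w₂} V :=
    { cohomologyTransfer.{w₁, w₂} F x with
      map_smul' := cohomologyTransfer_smul k F x }
  exact Module.Finite.of_surjective Ψ (cohomologyTransfer_surjective F hP x hx)

end Transfer

end TensorCohomology

theorem mainTheorem3 (k : Type u₀) [Field k]
    {D : Type u₁} [Category.{v₁} D] [Abelian D] [Linear k D] [MonoidalCategory D]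
    [MonoidalPreadditive D] [MonoidalLinear k D] [RigidCategory D]
    [TensorCohomology.IsFiniteTensorCategory k D]
    {C : Type u₂} [Category.{v₂} C] [Abelian C] [Linear k C] [MonoidalCategory C]
    [MonoidalPreadditive C] [MonoidalLinear k C] [RigidCategory C]
    [TensorCohomology.IsFiniteTensorCategory k C]
    -- a tensor functor: an exact `k`-linear (strong) monoidal functor
    (F : D ⥤ C) [F.Monoidal] [F.Additive] [F.Linear k] [PreservesFiniteLimits F]
    [PreservesFiniteColimits F]
    (hF : TensorCohomology.IsSurjectiveFunctor F)
    (hD : TensorCohomology.IsFiniteType k D) :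
    TensorCohomology.IsFiniteType k C ∧
      TensorCohomology.IsFiniteRingHom (TensorCohomology.cohomologyMap k F).toRingHom ∧
      TensorCohomology.kdim k C ≤ TensorCohomology.kdim k D := by
  have : EnoughProjectives D := TensorCohomology.IsFiniteTensorCategory.enoughProjectives k
  have : EnoughProjectives C := TensorCohomology.IsFiniteTensorCategory.enoughProjectives k
  have : ∀ X Y : D, Module.Finite k (X ⟶ Y) := TensorCohomology.IsFiniteTensorCategory.finite_hom
  have : ∀ X Y : C, Module.Finite k (X ⟶ Y) := TensorCohomology.IsFiniteTensorCategory.finite_hom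
  have hlen := TensorCohomology.IsFiniteTensorCategory.finite_length (C := D) k
  have : ∀ X : D, IsNoetherianObject X := fun X => (hlen X).1
  have hP : ∀ P : D, Projective P → Projective (F.obj P) := fun P _ =>
    TensorCohomology.projective_map_of_surjective k F hF P
  obtain ⟨Q, _, hQ⟩ := TensorCohomology.exists_projective_generator (C := D) k hlen
    (TensorCohomology.IsFiniteTensorCategory.finite_simples k)
  have hfin : ∀ V : C, @Module.Finite (TensorCohomology.Cohomology (𝟙_ D))
      (TensorCohomology.Cohomology V) _ _
      (Module.compHom _ (TensorCohomology.cohomologyMap k F).toRingHom) := fun V => by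
    obtain ⟨J, x, hx⟩ := TensorCohomology.exists_universal_map F k hQ V
    exact TensorCohomology.finite_cohomology_of_universal_map k F hP x hx (hD.2 J)
  have hmap : TensorCohomology.IsFiniteRingHom (TensorCohomology.cohomologyMap k F).toRingHom := by
    have h := hfin (𝟙_ C)
    rw [TensorCohomology.extTotal_module_self] at h
    exact h
  exact ⟨⟨TensorCohomology.finiteType_of_isFiniteRingHom _ hD.1 hmap,
    fun V => TensorCohomology.finite_of_finite_compHom _ (hfin V)⟩, hmap,
    TensorCohomology.primeKrullDim_le_of_finite (TensorCohomology.cohomologyMap k F) _ _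
      (TensorCohomology.cohomologyMap_mem_evenSubalgebra k F)
      (TensorCohomology.evenSubalgebra_central k) (TensorCohomology.evenSubalgebra_central k)
      (TensorCohomology.finite_evenSubalgebra k hD.1) hmap⟩
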